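/- Let $E_1=\prod_{j\ge 1}(1-q^j)$, and for a rational number $t\neq 0$ define the fractional partition function $p_t(n)\in\mathbb{Q}$ by $$\sum_{n=0}^\infty p_t(n)q^n=E_1^t .$$ For a positive integer $m$, the congruence $p_t(n)\equiv 0\pmod m$ means that the numerator of the rational number $p_t(n)$, written in lowest terms, is divisible by $m$. Then, for all integers $n\ge 0$, \begin{align*} p_{-1/6}(25n+r)&\equiv 0\pmod{25}, && r\in\{9,14,19,24\},\\ p_{1/6}(125n+r)&\equiv 0\pmod{25}, && r\in\{96,121\},\\ p_{-5/6}(125n+r)&\equiv 0\pmod{25}, && r\in\{95,120\},\\ p_{5/6}(25n+r)&\equiv 0\pmod{125}, && r\in\{15,20\},\\ p_{5/6}(125n+r)&\equiv 0\pmod{625}, && r\in\{65,70\}. \end{align*} -/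

import Mathlib

/-- Euler's product `E₁ = (q; q)_∞ = ∏_{j ≥ 0} (1 - q * q ^ j)`, as a formal power series in `q`
over `ℚ`. The infinite product is taken in the topology of coefficientwise convergence. -/
noncomputable def eulerE : PowerSeries ℚ :=
  letI : TopologicalSpace (PowerSeries ℚ) := PowerSeries.WithPiTopology.instTopologicalSpace ℚ
  ∏' j : ℕ, ((1 : PowerSeries ℚ) - PowerSeries.X ^ (j + 1))

/-- The product defining `E₁` converges, with value `eulerE`. -/
theorem hasProd_eulerE :
    letI : TopologicalSpace (PowerSeries ℚ) := PowerSeries.WithPiTopology.instTopologicalSpace ℚ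
    HasProd (fun j : ℕ => (1 : PowerSeries ℚ) - PowerSeries.X ^ (j + 1)) eulerE := by
  let : TopologicalSpace (PowerSeries ℚ) := PowerSeries.WithPiTopology.instTopologicalSpace ℚ
  exact (PowerSeries.WithPiTopology.hasProd_one_sub_X_pow ℚ).multipliable.hasProd

/-- `E₁` has constant term `1`. -/
theorem constantCoeff_eulerE : PowerSeries.constantCoeff eulerE = 1 := by
  let : TopologicalSpace (PowerSeries ℚ) := PowerSeries.WithPiTopology.instTopologicalSpace ℚ
  have h := hasProd_eulerE.map (PowerSeries.constantCoeff (R := ℚ))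
    (PowerSeries.WithPiTopology.continuous_constantCoeff ℚ)
  have h1 : (PowerSeries.constantCoeff (R := ℚ)) ∘
      (fun j : ℕ => (1 : PowerSeries ℚ) - PowerSeries.X ^ (j + 1)) = fun _ => 1 := by
    funext j
    simp
  rw [h1] at h
  exact h.unique hasProd_one

/-- The series `E₁ - 1` has no constant term, so it may be substituted into a power series. -/
theorem hasSubst_eulerE_sub_one : PowerSeries.HasSubst (eulerE - 1) :=
  PowerSeries.HasSubst.of_constantCoeff_zero' (by simp [constantCoeff_eulerE])

/-- The rational power `E₁ ^ t = (1 + (E₁ - 1)) ^ t`, given by the binomial series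
`∑ₖ (t choose k) (E₁ - 1) ^ k`. -/
noncomputable def eulerPow (t : ℚ) : PowerSeries ℚ :=
  (PowerSeries.binomialSeries ℚ t).subst (eulerE - 1)

/-- The fractional partition function `p_t(n)`: the coefficient of `q ^ n` in `E₁ ^ t`. -/
noncomputable def fracPartition (t : ℚ) (n : ℕ) : ℚ :=
  PowerSeries.coeff n (eulerPow t)

/-- The congruence `x ≡ 0 (mod m)` for a rational number `x`: the numerator of `x`, in lowest
terms, is divisible by `m`. -/
def RatCongZero (x : ℚ) (m : ℕ) : Prop :=
  (m : ℤ) ∣ x.num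

/-! Write E for Euler's product, an integral series by the pentagonal number theorem, and D_r for
the extraction of the exponents 5n + r. For fixed n the coefficient of q^n in E^t is a polynomial in
t, so congruences for E^N with integers N tending 5-adically to t pass to E^t
(`ratCongZero_fracPartition`). It remains to treat exponents N near ±1/6 and ±5/6.

The 5-dissection is E = A(q^5) - q E(q^25) + q^2 C(q^5) with AC = -E(q^5)^2. The product relation
comes from D_2(E^2), computed by counting lattice points on circles with a character and rotating by
(3 + 4i)/5. Taking the norm over fifth roots of unity gives the modular equation E^5 = τ(q^5) - 5u,
where τ = E^6/E(q^5) (`exists_quintic_pentagonalSeries`).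

Expanding powers of this equation gives the dissections of E^20, E^21, E^24 modulo 25 and of E^105
modulo 625. Together with E^(5^(k+1)) ≡ E(q^5)^(5^k) modulo 5^(k+1), they reduce the iterated
components of E^N to a series in q^5, or such a series times E. The vanishing follows because a
series in q^5 has no nonzero residues and D_3(E) = D_4(E) = 0. -/

namespace PowerSeries

theorem map_pentagonalSeries {R S : Type*} [CommRing R] [CommRing S] (f : R →+* S) :
    map f (pentagonalSeries R) = pentagonalSeries S := by
  ext n
  by_cases h : n ∈ Set.range pentagonal
  · obtain ⟨k, rfl⟩ := h
    simp
  · simp [coeff_pentagonalSeries_eq_zero _ h]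

theorem constantCoeff_pentagonalSeries (R : Type*) [CommRing R] :
    constantCoeff (pentagonalSeries R) = 1 := by
  have h := coeff_pentagonalSeries_pentagonal R 0
  rw [show pentagonal 0 = 0 from rfl] at h
  simpa using h

end PowerSeries

theorem eulerE_eq_map : eulerE = PowerSeries.map (Int.castRingHom ℚ)
    (PowerSeries.pentagonalSeries ℤ) := by
  rw [PowerSeries.map_pentagonalSeries]
  exact PowerSeries.WithPiTopology.tprod_one_sub_X_pow ℚ

/-! ### Interpolation in the exponent -/

theorem coeff_pow_eq_zero_of_constantCoeff_eq_zero {R : Type*} [CommRing R] {f : PowerSeries R}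
    (hf : PowerSeries.constantCoeff f = 0) {n k : ℕ} (h : n < k) :
    PowerSeries.coeff n (f ^ k) = 0 :=
  PowerSeries.X_pow_dvd_iff.1 (pow_dvd_pow_of_dvd (PowerSeries.X_dvd_iff.2 hf) k) n h

theorem fracPartition_eq_sum (t : ℚ) (n : ℕ) :
    fracPartition t n = ∑ k ∈ Finset.range (n + 1), Ring.choose t k *
      ((PowerSeries.coeff n ((PowerSeries.pentagonalSeries ℤ - 1) ^ k) : ℤ) : ℚ) := by
  have hc (k : ℕ) : ((PowerSeries.coeff n ((PowerSeries.pentagonalSeries ℤ - 1) ^ k) : ℤ) : ℚ) =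
      PowerSeries.coeff n ((eulerE - 1) ^ k) := by
    have h : (eulerE - 1) ^ k = PowerSeries.map (Int.castRingHom ℚ)
        ((PowerSeries.pentagonalSeries ℤ - 1) ^ k) := by
      rw [map_pow, map_sub, map_one, eulerE_eq_map]
    rw [h, PowerSeries.coeff_map]
    rfl
  rw [fracPartition, eulerPow, PowerSeries.coeff_subst' hasSubst_eulerE_sub_one,
    finsum_eq_sum_of_support_subset (s := Finset.range (n + 1))]
  · exact Finset.sum_congr rfl fun k _ => by simp [hc]
  · intro k hk
    by_contra hlt
    refine hk ?_
    have : n < k := by simpa using hlt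
    simp only
    rw [coeff_pow_eq_zero_of_constantCoeff_eq_zero (by simp [constantCoeff_eulerE]) this, smul_zero]

theorem fracPartition_natCast (N n : ℕ) :
    fracPartition N n = ((PowerSeries.coeff n (PowerSeries.pentagonalSeries ℤ ^ N) : ℤ) : ℚ) := by
  rw [fracPartition, eulerPow, PowerSeries.binomialSeries_nat,
    PowerSeries.subst_pow hasSubst_eulerE_sub_one, PowerSeries.subst_add hasSubst_eulerE_sub_one,
    PowerSeries.subst_X hasSubst_eulerE_sub_one, ← PowerSeries.coe_substAlgHom
      hasSubst_eulerE_sub_one, map_one, add_sub_cancel, eulerE_eq_map, ← map_pow,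
    PowerSeries.coeff_map]
  rfl

open Polynomial in
-- Clearing denominators in the falling factorial of a/d gives the product of a - i d over i < k.
theorem exists_intPolynomial_choose (d : ℤ) (hd : d ≠ 0) (k : ℕ) :
    ∃ P : ℤ[X], ∀ a : ℤ, (d : ℚ) ^ k * (k.factorial * Ring.choose ((a : ℚ) / d) k) = P.eval a := by
  suffices ∃ P : ℤ[X], ∀ a : ℤ,
      (d : ℚ) ^ k * (descPochhammer ℤ k).smeval ((a : ℚ) / d) = P.eval a by
    obtain ⟨P, hP⟩ := this
    refine ⟨P, fun a => ?_⟩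
    rw [← hP, Ring.descPochhammer_eq_factorial_smul_choose, nsmul_eq_mul]
  induction k with
  | zero => exact ⟨1, fun a => by simp⟩
  | succ k ih =>
    obtain ⟨P, hP⟩ := ih
    refine ⟨P * (X - C (d * k)), fun a => ?_⟩
    have hd' : (d : ℚ) ≠ 0 := by exact_mod_cast hd
    rw [descPochhammer_succ_right, smeval_mul, eval_mul, Int.cast_mul, ← hP, smeval_sub]
    simp only [smeval_X, smeval_natCast, eval_sub, eval_X, eval_C, pow_one, pow_zero, nsmul_eq_mul,
      mul_one]
    push_cast
    field_simp
    ring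

open Polynomial in
theorem exists_intPolynomial_fracPartition (d : ℤ) (hd : d ≠ 0) (n : ℕ) :
    ∃ Q : ℤ[X], ∀ a : ℤ,
      (d : ℚ) ^ n * n.factorial * fracPartition ((a : ℚ) / d) n = Q.eval a := by
  choose P hP using exists_intPolynomial_choose d hd
  refine ⟨∑ k ∈ Finset.range (n + 1), C (d ^ (n - k) * (n.factorial / k.factorial : ℕ) *
    PowerSeries.coeff n ((PowerSeries.pentagonalSeries ℤ - 1) ^ k)) * P k, fun a => ?_⟩
  rw [fracPartition_eq_sum, eval_finsetSum, Int.cast_sum, Finset.mul_sum]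
  refine Finset.sum_congr rfl fun k hk => ?_
  have hk : k ≤ n := Nat.lt_succ_iff.1 (Finset.mem_range.1 hk)
  rw [eval_mul, eval_C, Int.cast_mul, ← hP]
  have h1 : (n.factorial : ℚ) = ((n.factorial / k.factorial : ℕ) : ℚ) * k.factorial := by
    rw [← Nat.cast_mul, Nat.div_mul_cancel (Nat.factorial_dvd_factorial hk)]
  have h2 : (d : ℚ) ^ n = d ^ (n - k) * d ^ k := by rw [← pow_add, Nat.sub_add_cancel hk]
  rw [h1, h2]
  simp only [Int.cast_mul, Int.cast_pow, Int.cast_natCast]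
  ring

/-- Congruences for `E₁ ^ (a / d)` follow from those for integral powers with exponents
`p`-adically close to `a / d`. -/
theorem ratCongZero_fracPartition {p : ℕ} (hp : p.Prime) {d : ℤ} (hd : IsCoprime d (p : ℤ))
    (k n : ℕ) (a : ℤ)
    (h : ∀ j, ∃ N : ℕ, (p : ℤ) ^ j ∣ d * N - a ∧
      (p : ℤ) ^ k ∣ PowerSeries.coeff n (PowerSeries.pentagonalSeries ℤ ^ N)) :
    RatCongZero (fracPartition ((a : ℚ) / d) n) (p ^ k) := by
  have hd0 : d ≠ 0 := by
    rintro rfl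
    rw [isCoprime_zero_left, Int.isUnit_iff] at hd
    have := hp.two_le
    omega
  obtain ⟨Q, hQ⟩ := exists_intPolynomial_fracPartition d hd0 n
  -- The factor n! costs p^e, so the exponent must be approximated modulo p^(k + e); the remaining
  -- factors d^n and f are prime to p.
  obtain ⟨e, f, hpf, hf⟩ := Nat.exists_eq_pow_mul_and_not_dvd n.factorial_ne_zero p hp.ne_one
  obtain ⟨N, hN, c, hc⟩ := h (k + e)
  have h1 := hQ a
  have h2 := hQ (d * N)
  have hd1 : (d : ℚ) ≠ 0 := by exact_mod_cast hd0
  rw [Int.cast_mul, Int.cast_natCast, mul_div_cancel_left₀ _ hd1, fracPartition_natCast, hc] at h2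
  obtain ⟨z, hz⟩ := hN.trans (Polynomial.sub_dvd_eval_sub (d * N) a Q)
  have hz' : ((Q.eval (d * (N : ℤ)) : ℤ) : ℚ) - (Q.eval a : ℤ) = (p : ℚ) ^ (k + e) * z := by
    exact_mod_cast hz
  have hp0 : (p : ℚ) ^ e ≠ 0 := pow_ne_zero _ (by exact_mod_cast hp.ne_zero)
  set x := fracPartition ((a : ℚ) / d) n
  have hx : (d : ℚ) ^ n * f * x = p ^ k * (d ^ n * f * c - z) := by
    apply mul_left_cancel₀ hp0
    rw [← h1, ← h2, hf] at hz'
    push_cast at hz'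
    rw [pow_add] at hz'
    linear_combination -hz'
  have hx' : d ^ n * f * x.num = (p : ℤ) ^ k * ((d ^ n * f * c - z) * x.den) := by
    have : (d : ℚ) ^ n * f * x.num = p ^ k * ((d ^ n * f * c - z) * x.den) := by
      rw [← Rat.mul_den_eq_num x]
      linear_combination (x.den : ℚ) * hx
    exact_mod_cast this
  have hfp : IsCoprime (f : ℤ) (p : ℤ) :=
    Nat.isCoprime_iff_coprime.2 ((Nat.Prime.coprime_iff_not_dvd hp).2 hpf).symm
  have hcop : IsCoprime ((p : ℤ) ^ k) (d ^ n * f) :=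
    ((hd.pow_left (m := n)).mul_left hfp).symm.pow_left
  rw [RatCongZero]
  push_cast
  exact hcop.dvd_of_dvd_mul_left ⟨_, hx'⟩

/-! ### Character sums over lattice points -/

/-- The primitive even character modulo `12`. -/
def chi (x : ℤ) : ℤ :=
  if x % 12 = 1 ∨ x % 12 = 11 then 1 else if x % 12 = 5 ∨ x % 12 = 7 then -1 else 0

theorem chi_emod (x : ℤ) : chi (x % 12) = chi x := by
  simp [chi]

theorem chi_neg (x : ℤ) : chi (-x) = chi x := by
  unfold chi
  split_ifs <;> omega

theorem chi_five_mul (x : ℤ) : chi (5 * x) = -chi x := by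
  unfold chi
  split_ifs <;> omega

theorem sq_emod_of_chi_ne_zero {x : ℤ} (h : chi x ≠ 0) : x ^ 2 % 24 = 1 := by
  have : x % 24 = 1 ∨ x % 24 = 5 ∨ x % 24 = 7 ∨ x % 24 = 11 ∨ x % 24 = 13 ∨ x % 24 = 17 ∨
      x % 24 = 19 ∨ x % 24 = 23 := by
    unfold chi at h
    split_ifs at h <;> omega
  rcases this with h | h | h | h | h | h | h | h <;> simp [pow_two, Int.mul_emod, h]

/-- Multiplication by `(3 + 4i) / 5` reverses the sign of `chi x * chi y`. -/
theorem chi_mul_chi_rotate {x y u v : ℤ} (hu : 5 * u = 3 * x - 4 * y) (hv : 5 * v = 4 * x + 3 * y) :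
    chi u * chi v = -(chi x * chi y) := by
  -- Since 25 ≡ 1 modulo 12, u ≡ 5(5u), so u and v modulo 12 depend only on x and y modulo 12 and
  -- finitely many cases remain.
  have h1 : chi u = chi ((5 * (3 * (x % 12) - 4 * (y % 12))) % 12) := by
    rw [← chi_emod u]; congr 1; omega
  have h2 : chi v = chi ((5 * (4 * (x % 12) + 3 * (y % 12))) % 12) := by
    rw [← chi_emod v]; congr 1; omega
  rw [h1, h2, ← chi_emod x, ← chi_emod y]
  have hx := Int.emod_nonneg x (show (12 : ℤ) ≠ 0 by norm_num)
  have hx' := Int.emod_lt_of_pos x (show (0 : ℤ) < 12 by norm_num)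
  have hy := Int.emod_nonneg y (show (12 : ℤ) ≠ 0 by norm_num)
  have hy' := Int.emod_lt_of_pos y (show (0 : ℤ) < 12 by norm_num)
  generalize x % 12 = a at *
  generalize y % 12 = b at *
  have key : ∀ a ∈ Finset.Ico (0 : ℤ) 12, ∀ b ∈ Finset.Ico (0 : ℤ) 12,
      chi ((5 * (3 * a - 4 * b)) % 12) * chi ((5 * (4 * a + 3 * b)) % 12) =
        -(chi a * chi b) := by decide
  exact key a (by simp [hx, hx']) b (by simp [hy, hy'])

/-- The integers with square `M`. -/
noncomputable def intRoots (M : ℤ) : Finset ℤ := (Finset.Icc (-M) M).filter fun x => x ^ 2 = M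

theorem mem_intRoots {M x : ℤ} : x ∈ intRoots M ↔ x ^ 2 = M := by
  simp only [intRoots, Finset.mem_filter, Finset.mem_Icc, and_iff_right_iff_imp]
  rintro rfl
  rcases lt_trichotomy x 0 with h | h | h <;> constructor <;> nlinarith

/-- The integer points on the circle of radius `√M`. -/
noncomputable def intCircle (M : ℤ) : Finset (ℤ × ℤ) :=
  ((Finset.Icc (-M) M) ×ˢ (Finset.Icc (-M) M)).filter fun p => p.1 ^ 2 + p.2 ^ 2 = M

theorem mem_intCircle {M : ℤ} {p : ℤ × ℤ} : p ∈ intCircle M ↔ p.1 ^ 2 + p.2 ^ 2 = M := by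
  simp only [intCircle, Finset.mem_filter, Finset.mem_product, Finset.mem_Icc,
    and_iff_right_iff_imp]
  rintro rfl
  have h (z : ℤ) : -z ^ 2 ≤ z ∧ z ≤ z ^ 2 := by
    rcases lt_trichotomy z 0 with h | h | h <;> constructor <;> nlinarith
  have h1 := h p.1
  have h2 := h p.2
  have h3 := sq_nonneg p.1
  have h4 := sq_nonneg p.2
  constructor <;> constructor <;> linarith

open PowerSeries in
-- For n = k(3k - 1)/2 the roots are ±(6k - 1), both with character (-1)^k. A root with nonzero
-- character is ±1 modulo 6 and so makes n pentagonal.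
theorem two_mul_coeff_pentagonalSeries (n : ℕ) :
    2 * coeff n (pentagonalSeries ℤ) = ∑ x ∈ intRoots (24 * n + 1), chi x := by
  by_cases h : n ∈ Set.range pentagonal
  · obtain ⟨k, rfl⟩ := h
    have hk := two_mul_natCast_pentagonal k
    have hroots : intRoots (24 * pentagonal k + 1) = {6 * k - 1, -(6 * k - 1)} := by
      ext x
      rw [mem_intRoots, Finset.mem_insert, Finset.mem_singleton, ← sq_eq_sq_iff_eq_or_eq_neg]
      constructor <;> intro h
      · linear_combination h + 12 * hk
      · linear_combination h - 12 * hk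
    rw [hroots, Finset.sum_pair (by omega), chi_neg, coeff_pentagonalSeries_pentagonal, ← two_mul]
    congr 1
    rcases Int.even_or_odd k with he | ho
    · rw [Int.negOnePow_even k he]
      obtain ⟨m, rfl⟩ := he
      rw [chi, if_pos (by omega)]
      rfl
    · rw [Int.negOnePow_odd k ho]
      obtain ⟨m, rfl⟩ := ho
      rw [chi, if_neg (by omega), if_pos (by omega)]
      rfl
  · rw [coeff_pentagonalSeries_eq_zero _ h, mul_zero]
    refine (Finset.sum_eq_zero fun x hx => ?_).symm
    rw [mem_intRoots] at hx
    by_contra hchi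
    have hmod : x % 6 = 1 ∨ x % 6 = 5 := by
      unfold chi at hchi
      split_ifs at hchi <;> omega
    apply h
    rcases hmod with hm | hm
    · refine ⟨-(x / 6), ?_⟩
      have hk := two_mul_natCast_pentagonal (-(x / 6))
      have : x = 6 * (x / 6) + 1 := by omega
      generalize x / 6 = y at *
      subst this
      have : (24 : ℤ) * pentagonal (-y) = 24 * n := by linear_combination 12 * hk + hx
      omega
    · refine ⟨x / 6 + 1, ?_⟩
      have hk := two_mul_natCast_pentagonal (x / 6 + 1)
      have : x = 6 * (x / 6) + 5 := by omega
      generalize x / 6 = y at *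
      subst this
      have : (24 : ℤ) * pentagonal (y + 1) = 24 * n := by linear_combination 12 * hk + hx
      omega

open PowerSeries in
theorem four_mul_coeff_pentagonalSeries_sq (n : ℕ) :
    4 * coeff n (pentagonalSeries ℤ ^ 2) =
      ∑ p ∈ intCircle (24 * n + 2), chi p.1 * chi p.2 := by
  rw [pow_two, coeff_mul, Finset.mul_sum]
  have h1 : ∀ ij ∈ Finset.HasAntidiagonal.antidiagonal n,
      4 * (coeff ij.1 (pentagonalSeries ℤ) * coeff ij.2 (pentagonalSeries ℤ)) =
        ∑ p ∈ intRoots (24 * ij.1 + 1) ×ˢ intRoots (24 * ij.2 + 1), chi p.1 * chi p.2 := by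
    intro ij _
    rw [Finset.sum_product, ← Finset.sum_mul_sum, ← two_mul_coeff_pentagonalSeries,
      ← two_mul_coeff_pentagonalSeries]
    ring
  -- Only points of nonzero weight are sure to have both squares congruent to 1 modulo 24, hence to
  -- come from a pair (i, j); the others are dropped on both sides.
  rw [Finset.sum_congr rfl h1, Finset.sum_sigma', ← Finset.sum_filter_ne_zero (intCircle _)]
  rw [← Finset.sum_filter_ne_zero]
  refine Finset.sum_nbij' (fun s => s.2)
    (fun p => ⟨(((p.1 ^ 2 - 1) / 24).toNat, ((p.2 ^ 2 - 1) / 24).toNat), p⟩) ?_ ?_ ?_ ?_ ?_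
  · rintro ⟨⟨i, j⟩, ⟨x, y⟩⟩ h
    simp only [Finset.mem_filter, Finset.mem_sigma,
      Finset.HasAntidiagonal.mem_antidiagonal, Finset.mem_product, mem_intRoots, mem_intCircle] at h ⊢
    refine ⟨?_, h.2⟩
    have : (n : ℤ) = i + j := by exact_mod_cast h.1.1.symm
    linear_combination h.1.2.1 + h.1.2.2 - 24 * this
  · rintro ⟨x, y⟩ h
    simp only [Finset.mem_filter, Finset.mem_sigma,
      Finset.HasAntidiagonal.mem_antidiagonal, Finset.mem_product, mem_intRoots, mem_intCircle] at h ⊢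
    have hx := sq_emod_of_chi_ne_zero (left_ne_zero_of_mul h.2)
    have hy := sq_emod_of_chi_ne_zero (right_ne_zero_of_mul h.2)
    have hx0 := sq_nonneg x
    have hy0 := sq_nonneg y
    refine ⟨⟨?_, ?_, ?_⟩, h.2⟩ <;> omega
  · rintro ⟨⟨i, j⟩, ⟨x, y⟩⟩ h
    simp only [Finset.mem_filter, Finset.mem_sigma,
      Finset.HasAntidiagonal.mem_antidiagonal, Finset.mem_product, mem_intRoots] at h
    have h1 : ((x ^ 2 - 1) / 24).toNat = i := by omega
    have h2 : ((y ^ 2 - 1) / 24).toNat = j := by omega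
    simp only [h1, h2]
  · intro p _
    rfl
  · intro s _
    rfl

/-- The involution exchanging the two classes modulo `5` of points on a circle whose squared
radius is divisible by `5` leaves only the points divisible by `5`. -/
theorem sum_intCircle_of_five_dvd {M : ℤ} (hM : 5 ∣ M) :
    ∑ p ∈ intCircle M, chi p.1 * chi p.2 =
      -∑ p ∈ (intCircle M).filter (fun p => 5 ∣ p.1 ∧ 5 ∣ p.2), chi p.1 * chi p.2 := by
  have hrot : ∑ p ∈ (intCircle M).filter (fun p => 5 ∣ 2 * p.1 - p.2), chi p.1 * chi p.2 =
      -∑ p ∈ (intCircle M).filter (fun p => 5 ∣ 2 * p.1 + p.2), chi p.1 * chi p.2 := by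
    rw [← Finset.sum_neg_distrib]
    refine Finset.sum_nbij' (fun p => ((3 * p.1 - 4 * p.2) / 5, (4 * p.1 + 3 * p.2) / 5))
      (fun p => ((3 * p.1 + 4 * p.2) / 5, (-4 * p.1 + 3 * p.2) / 5)) ?_ ?_ ?_ ?_ ?_
    · rintro ⟨x, y⟩ h
      simp only [Finset.mem_filter, mem_intCircle] at h ⊢
      obtain ⟨u, hu⟩ : ∃ u, u = (3 * x - 4 * y) / 5 := ⟨_, rfl⟩
      obtain ⟨v, hv⟩ : ∃ v, v = (4 * x + 3 * y) / 5 := ⟨_, rfl⟩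
      rw [← hu, ← hv]
      have hu' : 5 * u = 3 * x - 4 * y := by omega
      have hv' : 5 * v = 4 * x + 3 * y := by omega
      refine ⟨?_, by omega⟩
      have : 25 * (u ^ 2 + v ^ 2) = 25 * M := by
        linear_combination (5 * u + (3 * x - 4 * y)) * hu' + (5 * v + (4 * x + 3 * y)) * hv' +
          25 * h.1
      omega
    · rintro ⟨x, y⟩ h
      simp only [Finset.mem_filter, mem_intCircle] at h ⊢
      obtain ⟨u, hu⟩ : ∃ u, u = (3 * x + 4 * y) / 5 := ⟨_, rfl⟩
      obtain ⟨v, hv⟩ : ∃ v, v = (-4 * x + 3 * y) / 5 := ⟨_, rfl⟩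
      rw [← hu, ← hv]
      have hu' : 5 * u = 3 * x + 4 * y := by omega
      have hv' : 5 * v = -4 * x + 3 * y := by omega
      refine ⟨?_, by omega⟩
      have : 25 * (u ^ 2 + v ^ 2) = 25 * M := by
        linear_combination (5 * u + (3 * x + 4 * y)) * hu' + (5 * v + (-4 * x + 3 * y)) * hv' +
          25 * h.1
      omega
    · rintro ⟨x, y⟩ h
      simp only [Finset.mem_filter] at h
      refine Prod.ext ?_ ?_ <;> simp only <;> omega
    · rintro ⟨x, y⟩ h
      simp only [Finset.mem_filter] at h
      refine Prod.ext ?_ ?_ <;> simp only <;> omega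
    · rintro ⟨x, y⟩ h
      simp only [Finset.mem_filter] at h
      simp only
      rw [chi_mul_chi_rotate (x := x) (y := y) (u := (3 * x - 4 * y) / 5)
        (v := (4 * x + 3 * y) / 5) (by omega) (by omega), neg_neg]
  have hunion : intCircle M = (intCircle M).filter (fun p => 5 ∣ 2 * p.1 - p.2) ∪
      (intCircle M).filter (fun p => 5 ∣ 2 * p.1 + p.2) := by
    rw [← Finset.filter_or, eq_comm, Finset.filter_eq_self]
    rintro ⟨x, y⟩ h
    rw [mem_intCircle] at h
    simp only at h ⊢
    -- (2x - y)(2x + y) = 5x² - M.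
    apply Int.Prime.dvd_mul' (by norm_num)
    obtain ⟨c, rfl⟩ := hM
    exact ⟨x ^ 2 - c, by push_cast; linear_combination -h⟩
  have hinter : (intCircle M).filter (fun p => 5 ∣ p.1 ∧ 5 ∣ p.2) =
      (intCircle M).filter (fun p => 5 ∣ 2 * p.1 - p.2) ∩
      (intCircle M).filter (fun p => 5 ∣ 2 * p.1 + p.2) := by
    rw [← Finset.filter_and]
    refine Finset.filter_congr fun p _ => ?_
    omega
  have h := Finset.sum_union_inter (s₁ := (intCircle M).filter (fun p => 5 ∣ 2 * p.1 - p.2))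
    (s₂ := (intCircle M).filter (fun p => 5 ∣ 2 * p.1 + p.2)) (f := fun p => chi p.1 * chi p.2)
  rw [← hunion, ← hinter, hrot] at h
  linear_combination h

theorem sum_intCircle_filter_five_dvd (M : ℤ) :
    ∑ p ∈ (intCircle (25 * M)).filter (fun p => 5 ∣ p.1 ∧ 5 ∣ p.2), chi p.1 * chi p.2 =
      ∑ p ∈ intCircle M, chi p.1 * chi p.2 := by
  refine (Finset.sum_nbij' (fun p => (5 * p.1, 5 * p.2)) (fun p => (p.1 / 5, p.2 / 5))
    ?_ ?_ ?_ ?_ ?_).symm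
  · rintro ⟨x, y⟩ h
    simp only [Finset.mem_filter, mem_intCircle] at h ⊢
    exact ⟨by linear_combination 25 * h, by omega, by omega⟩
  · rintro ⟨x, y⟩ h
    simp only [Finset.mem_filter, mem_intCircle] at h ⊢
    obtain ⟨h, ⟨u, rfl⟩, ⟨v, rfl⟩⟩ := h
    simp only [ne_eq, OfNat.ofNat_ne_zero, not_false_eq_true, Int.mul_ediv_cancel_left]
    have : 25 * (u ^ 2 + v ^ 2) = 25 * M := by linear_combination h
    omega
  · rintro ⟨x, y⟩ _
    refine Prod.ext ?_ ?_ <;> simp only <;> omega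
  · rintro ⟨x, y⟩ h
    simp only [Finset.mem_filter] at h
    refine Prod.ext ?_ ?_ <;> simp only <;> omega
  · rintro ⟨x, y⟩ _
    simp only [chi_five_mul]
    ring

open PowerSeries in
-- The squared radius 24(5n + 2) + 2 = 10(12n + 5) is divisible by 5, so only points with both
-- coordinates divisible by 5 count. They exist only if 5 ∣ n, and then scaling by 5 preserves the
-- weight.
theorem coeff_pentagonalSeries_sq_five_mul_add_two (n : ℕ) :
    coeff (5 * n + 2) (pentagonalSeries ℤ ^ 2) =
      -coeff n (expand 5 (by norm_num) (pentagonalSeries ℤ ^ 2)) := by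
  have h := four_mul_coeff_pentagonalSeries_sq (5 * n + 2)
  rw [sum_intCircle_of_five_dvd (by push_cast; omega)] at h
  rw [coeff_expand]
  split_ifs with hn
  · obtain ⟨m, rfl⟩ := hn
    rw [Nat.mul_div_cancel_left _ (by norm_num)]
    have h2 := four_mul_coeff_pentagonalSeries_sq m
    rw [show (24 * ((5 * (5 * m) + 2 : ℕ) : ℤ) + 2) = 25 * (24 * m + 2) by push_cast; ring,
      sum_intCircle_filter_five_dvd, ← h2] at h
    linarith
  · rw [Finset.filter_false_of_mem, Finset.sum_empty] at h
    · linarith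
    · rintro ⟨x, y⟩ hp ⟨⟨u, hu⟩, v, hv⟩
      rw [mem_intCircle] at hp
      simp only at hp hu hv
      subst hu hv
      push_cast at hp
      have : 25 * (u ^ 2 + v ^ 2) = 24 * (5 * n + 2) + 2 := by linear_combination hp
      omega

open PowerSeries in
-- 24(5n + 1) + 1 = 5(24n + 5), so every root is 5 times an integer; the sign is that of χ(5) = -1.
theorem coeff_pentagonalSeries_five_mul_add_one (n : ℕ) :
    coeff (5 * n + 1) (pentagonalSeries ℤ) =
      -coeff n (expand 5 (by norm_num) (pentagonalSeries ℤ)) := by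
  have h := two_mul_coeff_pentagonalSeries (5 * n + 1)
  have h5 : ∀ x ∈ intRoots (24 * (5 * n + 1 : ℕ) + 1), 5 ∣ x := by
    intro x hx
    rw [mem_intRoots] at hx
    have h25 : ((5 : ℕ) : ℤ) ∣ x ^ 2 := ⟨24 * n + 5, by push_cast at hx ⊢; linarith⟩
    exact Int.Prime.dvd_pow' (by norm_num) h25
  rw [coeff_expand]
  split_ifs with hn
  · obtain ⟨m, rfl⟩ := hn
    rw [Nat.mul_div_cancel_left _ (by norm_num)]
    have h2 := two_mul_coeff_pentagonalSeries m
    have : ∑ x ∈ intRoots (24 * (5 * (5 * m) + 1 : ℕ) + 1), chi x =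
        ∑ x ∈ intRoots (24 * m + 1), -chi x := by
      refine Finset.sum_nbij' (fun x => x / 5) (fun x => 5 * x) ?_ ?_ ?_ ?_ ?_
      · intro x hx
        obtain ⟨y, rfl⟩ := h5 x hx
        rw [mem_intRoots] at hx ⊢
        rw [Int.mul_ediv_cancel_left _ (by norm_num)]
        push_cast at hx
        linarith
      · intro x hx
        rw [mem_intRoots] at hx ⊢
        push_cast
        linarith
      · intro x hx
        exact Int.mul_ediv_cancel' (h5 x hx)
      · intro x _
        exact Int.mul_ediv_cancel_left _ (by norm_num)
      · intro x hx
        obtain ⟨y, rfl⟩ := h5 x hx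
        rw [Int.mul_ediv_cancel_left _ (by norm_num), chi_five_mul]
    rw [this, Finset.sum_neg_distrib, ← h2] at h
    linarith
  · have : intRoots (24 * (5 * n + 1 : ℕ) + 1) = ∅ := by
      rw [Finset.eq_empty_iff_forall_notMem]
      intro x hx
      obtain ⟨y, rfl⟩ := h5 x hx
      rw [mem_intRoots] at hx
      push_cast at hx
      have : 25 * y ^ 2 = 24 * (5 * n + 1) + 1 := by linear_combination hx
      omega
    rw [this, Finset.sum_empty] at h
    linarith

theorem sq_emod_five (x : ℤ) : x ^ 2 % 5 = 0 ∨ x ^ 2 % 5 = 1 ∨ x ^ 2 % 5 = 4 := by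
  have : x % 5 = 0 ∨ x % 5 = 1 ∨ x % 5 = 2 ∨ x % 5 = 3 ∨ x % 5 = 4 := by omega
  rcases this with h | h | h | h | h <;> simp [pow_two, Int.mul_emod, h]

open PowerSeries in
theorem coeff_pentagonalSeries_eq_zero_of_mod_five {n : ℕ} (hn : n % 5 = 3 ∨ n % 5 = 4) :
    coeff n (pentagonalSeries ℤ) = 0 := by
  have h := two_mul_coeff_pentagonalSeries n
  have : intRoots (24 * n + 1) = ∅ := by
    rw [Finset.eq_empty_iff_forall_notMem]
    intro x hx
    rw [mem_intRoots] at hx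
    have := sq_emod_five x
    omega
  rw [this, Finset.sum_empty] at h
  linarith

/-! ### Dissection modulo 5 of power series -/

namespace PowerSeries

/-- The part of a power series supported on exponents `r` modulo `5`: the series with `n`-th
coefficient that of `q ^ (5 * n + r)`. -/
noncomputable def dissect {R : Type*} [CommRing R] (r : ℕ) : R⟦X⟧ →ₗ[R] R⟦X⟧ where
  toFun f := mk fun n => coeff (5 * n + r) f
  map_add' f g := by ext n; simp
  map_smul' c f := by ext n; simp

/-- The substitution `q ↦ q ^ 5`. -/
noncomputable abbrev dilate {R : Type*} [CommRing R] : R⟦X⟧ →ₐ[R] R⟦X⟧ :=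
  expand 5 (by norm_num)

section

variable {R : Type*} [CommRing R]

theorem coeff_dissect (r n : ℕ) (f : R⟦X⟧) : coeff n (dissect r f) = coeff (5 * n + r) f := by
  simp [dissect]

theorem dissect_dilate_mul {r : ℕ} (hr : r < 5) (g f : R⟦X⟧) :
    dissect r (dilate g * f) = g * dissect r f := by
  ext n
  rw [coeff_dissect, coeff_mul, coeff_mul]
  symm
  refine Finset.sum_of_injOn (fun p => (5 * p.1, 5 * p.2 + r)) ?_ ?_ ?_ ?_
  · rintro ⟨a, b⟩ _ ⟨c, d⟩ _ h
    simp only [Prod.mk.injEq] at h ⊢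
    omega
  · rintro ⟨a, b⟩ h
    simp only [Finset.mem_coe, Finset.HasAntidiagonal.mem_antidiagonal] at h ⊢
    omega
  · rintro ⟨a, b⟩ h hn
    rw [coeff_expand, if_neg, zero_mul]
    rintro ⟨c, hc⟩
    refine hn ⟨(c, n - c), ?_, ?_⟩
    · simp only [Finset.mem_coe, Finset.HasAntidiagonal.mem_antidiagonal] at h ⊢
      omega
    · simp only [Finset.HasAntidiagonal.mem_antidiagonal, Prod.mk.injEq] at h ⊢
      omega
  · rintro ⟨a, b⟩ _
    rw [coeff_expand_mul, coeff_dissect]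

theorem dissect_X_pow_mul_dilate {r s : ℕ} (hr : r < 5) (hs : s < 5) (f : R⟦X⟧) :
    dissect r (X ^ s * dilate f) = if r = s then f else 0 := by
  ext n
  rw [coeff_dissect, coeff_X_pow_mul', coeff_expand]
  split_ifs with h1 h2 h3 h3 h3
  · subst h3
    congr
    omega
  · omega
  · omega
  · simp
  · omega
  · simp

theorem dissect_dilate {r : ℕ} (hr : r < 5) (hr0 : r ≠ 0) (f : R⟦X⟧) : dissect r (dilate f) = 0 := by
  simpa [hr0] using dissect_X_pow_mul_dilate hr (show 0 < 5 by norm_num) f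

theorem dissect_zero_dilate (f : R⟦X⟧) : dissect 0 (dilate f) = f := by
  simpa using dissect_X_pow_mul_dilate (show 0 < 5 by norm_num) (show 0 < 5 by norm_num) f

theorem eq_sum_X_pow_mul_dilate_dissect (f : R⟦X⟧) :
    f = ∑ r ∈ Finset.range 5, X ^ r * dilate (dissect r f) := by
  ext n
  rw [map_sum, Finset.sum_eq_single (n % 5)]
  · rw [coeff_X_pow_mul', if_pos (Nat.mod_le n 5), coeff_expand, if_pos (by omega), coeff_dissect]
    congr
    omega
  · intro r hr hne
    rw [Finset.mem_range] at hr
    rw [coeff_X_pow_mul']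
    split_ifs
    · rw [coeff_expand, if_neg (by omega)]
    · rfl
  · intro h
    exact absurd (Finset.mem_range.2 (Nat.mod_lt n (by norm_num))) h

theorem map_dissect {S : Type*} [CommRing S] (φ : R →+* S) (r : ℕ) (f : R⟦X⟧) :
    map φ (dissect r f) = dissect r (map φ f) := by
  ext n
  simp [coeff_dissect]

end

/-! ### The dissection of Euler's product -/

theorem dissect_one_pentagonalSeries :
    dissect 1 (pentagonalSeries ℤ) = -dilate (pentagonalSeries ℤ) := by
  ext n
  rw [coeff_dissect, coeff_pentagonalSeries_five_mul_add_one, map_neg]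

theorem dissect_two_pentagonalSeries_sq :
    dissect 2 (pentagonalSeries ℤ ^ 2) = -dilate (pentagonalSeries ℤ) ^ 2 := by
  ext n
  rw [coeff_dissect, coeff_pentagonalSeries_sq_five_mul_add_two, map_neg, map_pow]

theorem dissect_pentagonalSeries_eq_zero {r : ℕ} (hr : r = 3 ∨ r = 4) :
    dissect r (pentagonalSeries ℤ) = 0 := by
  ext n
  rw [coeff_dissect, coeff_pentagonalSeries_eq_zero_of_mod_five (by omega), map_zero]

/-- The `5`-dissection of Euler's product. -/
theorem pentagonalSeries_eq_dissection :
    pentagonalSeries ℤ = dilate (dissect 0 (pentagonalSeries ℤ)) -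
      X * dilate (dilate (pentagonalSeries ℤ)) +
      X ^ 2 * dilate (dissect 2 (pentagonalSeries ℤ)) := by
  conv_lhs => rw [eq_sum_X_pow_mul_dilate_dissect (pentagonalSeries ℤ)]
  simp only [Finset.sum_range_succ, Finset.sum_range_zero, dissect_one_pentagonalSeries,
    dissect_pentagonalSeries_eq_zero (Or.inl rfl), dissect_pentagonalSeries_eq_zero (Or.inr rfl),
    map_neg, map_zero]
  ring

/-- With B = E(q^5), squaring the dissection gives D_2(E²) = B² + 2AC, whereas the lattice count
gives -B². -/
theorem dissect_zero_mul_dissect_two_pentagonalSeries :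
    dissect 0 (pentagonalSeries ℤ) * dissect 2 (pentagonalSeries ℤ) =
      -dilate (pentagonalSeries ℤ) ^ 2 := by
  have h := dissect_two_pentagonalSeries_sq
  have h2 : pentagonalSeries ℤ ^ 2 =
      X ^ 0 * dilate (dissect 0 (pentagonalSeries ℤ) ^ 2)
      + X ^ 1 * dilate (-2 * dissect 0 (pentagonalSeries ℤ) * dilate (pentagonalSeries ℤ))
      + X ^ 2 * dilate (dilate (pentagonalSeries ℤ) ^ 2 +
          2 * dissect 0 (pentagonalSeries ℤ) * dissect 2 (pentagonalSeries ℤ))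
      + X ^ 3 * dilate (-2 * dilate (pentagonalSeries ℤ) * dissect 2 (pentagonalSeries ℤ))
      + X ^ 4 * dilate (dissect 2 (pentagonalSeries ℤ) ^ 2) := by
    conv_lhs => rw [pentagonalSeries_eq_dissection]
    simp only [map_mul, map_add, map_pow, map_neg, map_ofNat]
    ring
  rw [h2] at h
  have h5 : 2 < 5 := by norm_num
  rw [map_add, map_add, map_add, map_add, dissect_X_pow_mul_dilate h5 (by norm_num),
    dissect_X_pow_mul_dilate h5 (by norm_num), dissect_X_pow_mul_dilate h5 (by norm_num),
    dissect_X_pow_mul_dilate h5 (by norm_num), dissect_X_pow_mul_dilate h5 (by norm_num)] at h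
  simp only [OfNat.ofNat_ne_zero, if_false, if_true, OfNat.ofNat_ne_one, Nat.reduceEqDiff,
    zero_add, add_zero] at h
  have h3 : (2 : ℤ⟦X⟧) ≠ 0 := fun h0 => by
    simpa [map_ofNat] using congrArg (constantCoeff (R := ℤ)) h0
  apply mul_left_cancel₀ h3
  linear_combination h

end PowerSeries

/-! ### The norm over fifth roots of unity -/

section

variable {R : Type*} [CommRing R]

theorem prod_one_sub_pow_mul_of_sum_pow_eq_zero {z : R} (hz : 1 + z + z ^ 2 + z ^ 3 + z ^ 4 = 0)
    (y : R) : ∏ k ∈ Finset.range 5, (1 - z ^ k * y) = 1 - y ^ 5 := by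
  simp only [Finset.prod_range_succ, Finset.prod_range_zero]
  grind

/-- Pairing k with 5 - k leaves only s = z + z⁴, which satisfies s² + s = 1. -/
theorem prod_dissection_of_sum_pow_eq_zero {z : R} (hz : 1 + z + z ^ 2 + z ^ 3 + z ^ 4 = 0)
    {a b c : R} (h : a * c = -b ^ 2) :
    ∏ k ∈ Finset.range 5, (a - z ^ k * b + (z ^ k) ^ 2 * c) = a ^ 5 - 11 * b ^ 5 + c ^ 5 := by
  have h5 : z ^ 5 = 1 := by linear_combination (z - 1) * hz
  have h1 : (a - z * b + z ^ 2 * c) * (a - z ^ 4 * b + z ^ 8 * c) =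
      (a ^ 2 + 2 * b ^ 2 + c ^ 2) - (z + z ^ 4) * (b * (a + c) - b ^ 2) := by
    grind
  have h2 : (a - z ^ 2 * b + z ^ 4 * c) * (a - z ^ 3 * b + z ^ 6 * c) =
      (a ^ 2 + 2 * b ^ 2 + c ^ 2) + (1 + (z + z ^ 4)) * (b * (a + c) - b ^ 2) := by
    grind
  have hs : (z + z ^ 4) ^ 2 + (z + z ^ 4) - 1 = 0 := by grind
  calc _ = (a - b + c) * ((a - z * b + z ^ 2 * c) * (a - z ^ 4 * b + z ^ 8 * c)) *
        ((a - z ^ 2 * b + z ^ 4 * c) * (a - z ^ 3 * b + z ^ 6 * c)) := by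
        simp only [Finset.prod_range_succ, Finset.prod_range_zero]
        ring
    _ = _ := by
        rw [h1, h2]
        generalize z + z ^ 4 = s at hs
        grind

/-- As a + c = x + b and ac = -b², a⁵ + c⁵ is a polynomial in x and b, whose b⁵ term 1 + 5 + 5 = 11
cancels. -/
theorem quintic_of_dissection {a b c x t : R} (h : a * c = -b ^ 2) (hx : x = a - b + c)
    (ht : t = a ^ 5 - 11 * b ^ 5 + c ^ 5) :
    x ^ 5 + 5 * x ^ 4 * b + 15 * x ^ 3 * b ^ 2 + 25 * x ^ 2 * b ^ 3 + 25 * x * b ^ 4 = t := by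
  grind

end

namespace PowerSeries

open WithPiTopology Finset in
-- The conjugates of 1 - q^m multiply to 1 - q^(5m) if 5 ∤ m and to (1 - q^m)^5 if 5 ∣ m. The factor
-- E(q^25) supplies the missing 1 - q^(5m) with 5 ∣ m.
theorem prod_rescale_pentagonalSeries {K : Type*} [Field K] {z : K} (hz : IsPrimitiveRoot z 5) :
    (∏ k ∈ range 5, rescale (z ^ k) (pentagonalSeries K)) * dilate (dilate (pentagonalSeries K)) =
      dilate (pentagonalSeries K) ^ 6 := by
  let : TopologicalSpace K := ⊥
  have : DiscreteTopology K := ⟨rfl⟩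
  have := WithPiTopology.instIsTopologicalRing K
  have := WithPiTopology.instT2Space (R := K)
  have hP := hasProd_one_sub_X_pow K
  have hcd : Continuous (dilate (R := K)) := by
    refine continuous_iff_continuousAt.2 fun f => (tendsto_iff_coeff_tendsto _ _ _ _).2 fun n => ?_
    simp only [coeff_expand]
    split_ifs
    · exact (continuous_coeff K _).continuousAt
    · exact tendsto_const_nhds
  have hcr (c : K) : Continuous (rescale c) := by
    refine continuous_iff_continuousAt.2 fun f => (tendsto_iff_coeff_tendsto _ _ _ _).2 fun n => ?_
    simp only [coeff_rescale]
    exact ((continuous_coeff K n).const_mul _).continuousAt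
  have hF : HasProd (fun n : ℕ => (1 : K⟦X⟧) - X ^ (5 * (n + 1))) (dilate (pentagonalSeries K)) := by
    simpa [Function.comp_def, ← pow_mul] using hP.map (dilate (R := K)) hcd
  have hB : HasProd (fun n : ℕ => (1 : K⟦X⟧) - X ^ (25 * (n + 1)))
      (dilate (dilate (pentagonalSeries K))) := by
    simpa [Function.comp_def, ← pow_mul, ← mul_assoc] using hF.map (dilate (R := K)) hcd
  -- Index n stands for the exponent n + 1, so multiples of 5 are the indices 5m + 4; padding with 1
  -- elsewhere lets all products be compared factor by factor.
  have hinj : Function.Injective fun m : ℕ => 5 * m + 4 := fun a b h => by simpa using h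
  have hG : HasProd (fun n : ℕ => if 5 ∣ n + 1 then (1 : K⟦X⟧) - X ^ (5 * (n + 1)) else 1)
      (dilate (dilate (pentagonalSeries K))) := by
    rw [← hinj.hasProd_iff]
    · convert hB using 2 with m
      simp only [Function.comp_apply]
      rw [if_pos (by omega)]
      ring
    · intro n hn
      rw [if_neg]
      exact fun ⟨c, hc⟩ => hn ⟨c - 1, by simp only; omega⟩
  have hH : HasProd (fun n : ℕ => if 5 ∣ n + 1 then ((1 : K⟦X⟧) - X ^ (n + 1)) ^ 5 else 1)
      (dilate (pentagonalSeries K) ^ 5) := by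
    rw [← hinj.hasProd_iff]
    · have h5 := hasProd_prod (s := range 5) (fun _ _ => hF)
      simp only [prod_const, card_range] at h5
      convert h5 using 2 with m
      simp only [Function.comp_apply]
      rw [if_pos (by omega)]
      ring
    · intro n hn
      rw [if_neg]
      exact fun ⟨c, hc⟩ => hn ⟨c - 1, by simp only; omega⟩
  have hR := hasProd_prod (s := range 5)
    (fun k _ => hP.map (rescale (z ^ k)) (hcr (z ^ k)))
  have hL := hR.mul hG
  rw [pow_succ']
  refine hL.unique ?_
  convert hF.mul hH using 2 with n
  have hterm (k : ℕ) : rescale (z ^ k) ((1 : K⟦X⟧) - X ^ (n + 1)) =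
      1 - (C (z ^ (n + 1))) ^ k * X ^ (n + 1) := by
    simp only [map_sub, map_one, map_pow, rescale_X, mul_pow]
    ring
  simp only [Function.comp_apply, hterm]
  split_ifs with h
  · obtain ⟨c, hc⟩ := h
    rw [hc, pow_mul z, hz.pow_eq_one]
    simp
    ring
  · have hp : IsPrimitiveRoot (z ^ (n + 1)) 5 :=
      hz.pow_of_coprime _ ((Nat.Prime.coprime_iff_not_dvd (by norm_num)).2 h).symm
    have hsum := hp.geom_sum_eq_zero (by norm_num)
    have := congrArg (C (R := K)) hsum
    simp only [sum_range_succ, sum_range_zero, map_add, map_pow, map_zero] at this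
    rw [prod_one_sub_pow_mul_of_sum_pow_eq_zero]
    · ring
    · simp only [map_pow]
      linear_combination this

theorem rescale_dilate {R : Type*} [CommRing R] {c : R} (hc : c ^ 5 = 1) (f : R⟦X⟧) :
    rescale c (dilate f) = dilate f := by
  ext n
  rw [coeff_rescale, coeff_expand]
  split_ifs with h
  · obtain ⟨m, rfl⟩ := h
    rw [pow_mul, hc, one_pow, one_mul]
  · rw [mul_zero]

theorem map_int_injective {K : Type*} [Ring K] [CharZero K] :
    Function.Injective (map (Int.castRingHom K)) := by
  intro f g h
  ext n
  have := congrArg (coeff n) h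
  simpa using this

/-- The `5`-norm of Euler's product in terms of its `5`-dissection. -/
theorem norm_pentagonalSeries :
    (dilate (dissect 0 (pentagonalSeries ℤ)) ^ 5 -
      11 * (X * dilate (dilate (pentagonalSeries ℤ))) ^ 5 +
      (X ^ 2 * dilate (dissect 2 (pentagonalSeries ℤ))) ^ 5) *
      dilate (dilate (pentagonalSeries ℤ)) = dilate (pentagonalSeries ℤ) ^ 6 := by
  -- An identity of integral series may be checked over ℂ, which contains the fifth roots of unity.
  have hz := Complex.isPrimitiveRoot_exp 5 (by norm_num)
  generalize Complex.exp (2 * Real.pi * Complex.I / (5 : ℕ)) = z at hz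
  apply map_int_injective (K := ℂ)
  have hm := prod_rescale_pentagonalSeries hz
  rw [← map_pentagonalSeries (Int.castRingHom ℂ)] at hm
  have hmul := congrArg (map (Int.castRingHom ℂ)) dissect_zero_mul_dissect_two_pentagonalSeries
  have hdis := congrArg (map (Int.castRingHom ℂ)) pentagonalSeries_eq_dissection
  simp only [map_add, map_sub, map_mul, map_pow, map_neg, map_X, map_expand, map_ofNat]
    at hmul hdis hm ⊢
  generalize map (Int.castRingHom ℂ) (dissect 0 (pentagonalSeries ℤ)) = a at *
  generalize map (Int.castRingHom ℂ) (dissect 2 (pentagonalSeries ℤ)) = c at *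
  rw [← hm]
  congr 1
  have hfac (k : ℕ) : rescale (z ^ k) (map (Int.castRingHom ℂ) (pentagonalSeries ℤ)) =
      dilate a - C z ^ k * (X * dilate (dilate (map (Int.castRingHom ℂ) (pentagonalSeries ℤ)))) +
        (C z ^ k) ^ 2 * (X ^ 2 * dilate c) := by
    have hzk : (z ^ k) ^ 5 = 1 := by rw [← pow_mul, mul_comm, pow_mul, hz.pow_eq_one, one_pow]
    conv_lhs => rw [hdis]
    simp only [map_add, map_sub, map_mul, map_pow, rescale_dilate hzk, rescale_X]
    ring
  simp only [hfac]
  symm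
  apply prod_dissection_of_sum_pow_eq_zero
  · have := congrArg (C (R := ℂ)) (hz.geom_sum_eq_zero (by norm_num))
    simp only [Finset.sum_range_succ, Finset.sum_range_zero, map_add, map_pow, map_zero] at this
    linear_combination this
  · have := congrArg (dilate (R := ℂ)) hmul
    simp only [map_mul, map_neg, map_pow] at this
    linear_combination X ^ 2 * this

end PowerSeries

/-! ### The modular equation and dissections of powers -/

namespace PowerSeries

section

variable {R : Type*} [CommRing R]

theorem dissect_eq_of_eq_sum {f h₀ h₁ h₂ h₃ h₄ : R⟦X⟧}
    (hf : f = dilate h₀ + X ^ 1 * dilate h₁ + X ^ 2 * dilate h₂ + X ^ 3 * dilate h₃ +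
      X ^ 4 * dilate h₄) :
    dissect 0 f = h₀ ∧ dissect 1 f = h₁ ∧ dissect 2 f = h₂ ∧ dissect 3 f = h₃ ∧
      dissect 4 f = h₄ := by
  have hf' : f = X ^ 0 * dilate h₀ + X ^ 1 * dilate h₁ + X ^ 2 * dilate h₂ + X ^ 3 * dilate h₃ +
      X ^ 4 * dilate h₄ := by rw [hf, pow_zero, one_mul]
  have key {r : ℕ} (hr : r < 5) : dissect r f = (if r = 0 then h₀ else 0) +
      (if r = 1 then h₁ else 0) + (if r = 2 then h₂ else 0) + (if r = 3 then h₃ else 0) +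
      (if r = 4 then h₄ else 0) := by
    rw [hf', map_add, map_add, map_add, map_add, dissect_X_pow_mul_dilate hr (by norm_num),
      dissect_X_pow_mul_dilate hr (by norm_num), dissect_X_pow_mul_dilate hr (by norm_num),
      dissect_X_pow_mul_dilate hr (by norm_num), dissect_X_pow_mul_dilate hr (by norm_num)]
  refine ⟨?_, ?_, ?_, ?_, ?_⟩ <;> rw [key (by norm_num)] <;> simp

theorem dissect_X_pow_mul_of_le {r s : ℕ} (h : s ≤ r) (f : R⟦X⟧) :
    dissect r (X ^ s * f) = dissect (r - s) f := by
  ext n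
  rw [coeff_dissect, coeff_dissect, coeff_X_pow_mul', if_pos (by omega)]
  congr 2
  omega

theorem dissect_X_pow_mul_of_lt {r s : ℕ} (h : r < s) (hs : s < 5) (f : R⟦X⟧) :
    dissect r (X ^ s * f) = X * dissect (r + 5 - s) f := by
  ext n
  rw [coeff_dissect, coeff_X_pow_mul']
  cases n with
  | zero => rw [if_neg (by omega)]; simp
  | succ n =>
    rw [if_pos (by omega), coeff_succ_X_mul, coeff_dissect]
    congr 2
    omega

end

/-- This component is -B³ - 6ABC, which depends on A and C only through AC = -B². -/
theorem dissect_three_pentagonalSeries_cube :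
    dissect 3 (pentagonalSeries ℤ ^ 3) = 5 * dilate (pentagonalSeries ℤ) ^ 3 := by
  have hP := pentagonalSeries_eq_dissection
  have hac := dissect_zero_mul_dissect_two_pentagonalSeries
  generalize dissect 0 (pentagonalSeries ℤ) = a at hP hac
  generalize dissect 2 (pentagonalSeries ℤ) = c at hP hac
  have h := (dissect_eq_of_eq_sum (f := pentagonalSeries ℤ ^ 3)
    (h₀ := a ^ 3 - 3 * X * dilate (pentagonalSeries ℤ) * c ^ 2)
    (h₁ := -3 * a ^ 2 * dilate (pentagonalSeries ℤ) + X * c ^ 3)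
    (h₂ := 3 * a * dilate (pentagonalSeries ℤ) ^ 2 + 3 * a ^ 2 * c)
    (h₃ := -dilate (pentagonalSeries ℤ) ^ 3 - 6 * a * dilate (pentagonalSeries ℤ) * c)
    (h₄ := 3 * dilate (pentagonalSeries ℤ) ^ 2 * c + 3 * a * c ^ 2) (by
      conv_lhs => rw [hP]
      simp only [map_mul, map_add, map_sub, map_pow, map_neg, map_ofNat, expand_X]
      ring)).2.2.2.1
  rw [h]
  linear_combination -6 * dilate (pentagonalSeries ℤ) * hac

/-- Here B⁴ + 12AB²C + 6A²C² = (1 - 12 + 6)B⁴. -/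
theorem dissect_four_pentagonalSeries_pow_four :
    dissect 4 (pentagonalSeries ℤ ^ 4) = -5 * dilate (pentagonalSeries ℤ) ^ 4 := by
  have hP := pentagonalSeries_eq_dissection
  have hac := dissect_zero_mul_dissect_two_pentagonalSeries
  generalize dissect 0 (pentagonalSeries ℤ) = a at hP hac
  generalize dissect 2 (pentagonalSeries ℤ) = c at hP hac
  have h := (dissect_eq_of_eq_sum (f := pentagonalSeries ℤ ^ 4)
    (h₀ := a ^ 4 + X * (-4 * dilate (pentagonalSeries ℤ) ^ 3 * c
      - 12 * a * dilate (pentagonalSeries ℤ) * c ^ 2))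
    (h₁ := -4 * a ^ 3 * dilate (pentagonalSeries ℤ)
      + X * (6 * dilate (pentagonalSeries ℤ) ^ 2 * c ^ 2 + 4 * a * c ^ 3))
    (h₂ := 6 * a ^ 2 * dilate (pentagonalSeries ℤ) ^ 2 + 4 * a ^ 3 * c
      - X * (4 * dilate (pentagonalSeries ℤ) * c ^ 3))
    (h₃ := -4 * a * dilate (pentagonalSeries ℤ) ^ 3
      - 12 * a ^ 2 * dilate (pentagonalSeries ℤ) * c + X * c ^ 4)
    (h₄ := dilate (pentagonalSeries ℤ) ^ 4 + 12 * a * dilate (pentagonalSeries ℤ) ^ 2 * c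
      + 6 * a ^ 2 * c ^ 2) (by
      conv_lhs => rw [hP]
      simp only [map_mul, map_add, map_sub, map_pow, map_neg, map_ofNat, expand_X]
      ring)).2.2.2.2
  rw [h]
  linear_combination (12 * dilate (pentagonalSeries ℤ) ^ 2 + 6 * a * c -
    6 * dilate (pentagonalSeries ℤ) ^ 2) * hac

theorem isUnit_of_constantCoeff_eq_one {R : Type*} [CommRing R] {f : R⟦X⟧}
    (h : constantCoeff f = 1) : IsUnit f := by
  rw [isUnit_iff_constantCoeff, h]
  exact isUnit_one

/-- The modular equation of degree `5` for Euler's product. -/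
theorem exists_quintic_pentagonalSeries :
    ∃ τ : ℤ⟦X⟧, dilate (pentagonalSeries ℤ) * τ = pentagonalSeries ℤ ^ 6 ∧
      ∀ b, b = X * dilate (dilate (pentagonalSeries ℤ)) →
      pentagonalSeries ℤ ^ 5 = dilate τ - 5 * (pentagonalSeries ℤ * b *
        (pentagonalSeries ℤ ^ 3 + 3 * pentagonalSeries ℤ ^ 2 * b + 5 * pentagonalSeries ℤ * b ^ 2
          + 5 * b ^ 3)) := by
  have hu : IsUnit (dilate (pentagonalSeries ℤ)) :=
    isUnit_of_constantCoeff_eq_one (by simp [constantCoeff_pentagonalSeries])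
  -- τ = E⁶/E(q^5) is chosen so that τ(q^5) is the norm of E.
  obtain ⟨τ, hτ⟩ := hu.dvd (a := pentagonalSeries ℤ ^ 6)
  refine ⟨τ, hτ.symm, ?_⟩
  rintro b rfl
  have hB : IsUnit (dilate (dilate (pentagonalSeries ℤ))) := hu.map _
  have hac := congrArg dilate dissect_zero_mul_dissect_two_pentagonalSeries
  simp only [map_mul, map_neg, map_pow] at hac
  have hN := norm_pentagonalSeries
  have hτ' := congrArg dilate hτ
  rw [map_mul, map_pow] at hτ'
  rw [hτ', mul_comm] at hN
  have h := quintic_of_dissection (a := dilate (dissect 0 (pentagonalSeries ℤ)))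
    (b := X * dilate (dilate (pentagonalSeries ℤ)))
    (c := X ^ 2 * dilate (dissect 2 (pentagonalSeries ℤ)))
    (by linear_combination X ^ 2 * hac) pentagonalSeries_eq_dissection (hB.mul_left_cancel hN).symm
  linear_combination h

theorem exists_sub_five_mul_pow_four {R : Type*} [CommRing R] (t u : R) :
    ∃ z, (t - 5 * u) ^ 4 = t ^ 4 - 20 * t ^ 3 * u + 25 * z :=
  ⟨6 * t ^ 2 * u ^ 2 - 20 * t * u ^ 3 + 25 * u ^ 4, by ring⟩

/-- The cubic coefficient is -1330 · 5³ with 5 ∣ 1330, so everything beyond the square vanishes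
modulo 5⁴. -/
theorem exists_sub_five_mul_pow_twentyOne {R : Type*} [CommRing R] (t u : R) :
    ∃ z, (t - 5 * u) ^ 21 = t ^ 21 - 105 * t ^ 20 * u + 5250 * t ^ 19 * u ^ 2 + 625 * z :=
  ⟨-266 * t ^ 18 * u ^ 3 + 5985 * t ^ 17 * u ^ 4 - 101745 * t ^ 16 * u ^ 5 + 1356600 * t ^
      15 * u ^ 6 - 14535000 * t ^ 14 * u ^ 7 + 127181250 * t ^ 13 * u ^ 8 - 918531250 * t ^ 12
      * u ^ 9 + 5511187500 * t ^ 11 * u ^ 10 - 27555937500 * t ^ 10 * u ^ 11 + 114816406250 *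
      t ^ 9 * u ^ 12 - 397441406250 * t ^ 8 * u ^ 13 + 1135546875000 * t ^ 7 * u ^ 14 -
      2649609375000 * t ^ 6 * u ^ 15 + 4968017578125 * t ^ 5 * u ^ 16 - 7305908203125 * t ^ 4
      * u ^ 17 + 8117675781250 * t ^ 3 * u ^ 18 - 6408691406250 * t ^ 2 * u ^ 19 +
      3204345703125 * t ^ 1 * u ^ 20 - 762939453125 * u ^ 21, by ring⟩

/-- E^24 = (τ(q^5) - 5u)⁴ E⁴, and D_4(u E⁴) ≡ (5 - 3)τf⁴ modulo 5. The total is (-5 - 20 · 2)τ⁴f⁴ =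
-45 E^24 modulo 25. -/
theorem dissect_four_pentagonalSeries_pow_twentyFour : ∃ w : ℤ⟦X⟧,
    dissect 4 (pentagonalSeries ℤ ^ 24) = 5 * pentagonalSeries ℤ ^ 24 + 25 * w := by
  obtain ⟨τ, hτ, h5⟩ := exists_quintic_pentagonalSeries
  have h3 := dissect_three_pentagonalSeries_cube
  have h4 := dissect_four_pentagonalSeries_pow_four
  have h2 := dissect_two_pentagonalSeries_sq
  specialize h5 _ rfl
  generalize pentagonalSeries ℤ = p at *
  set f := dilate p with hf
  set v := (X * dilate f) ^ 3 * p ^ 2 + (X * dilate f) ^ 4 * p with hv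
  obtain ⟨u, hu⟩ : ∃ u, u = X * dilate f * (p ^ 4 + 3 * p ^ 3 * (X * dilate f)) + 5 * v := ⟨_, rfl⟩
  have h5' : p ^ 5 = dilate τ - 5 * u := by rw [h5, hu, hv]; ring
  obtain ⟨z, hz⟩ := exists_sub_five_mul_pow_four (dilate τ) u
  -- Only u modulo 5 matters, and there p⁵ may be replaced by τ(q^5), which passes through the
  -- dissection.
  have hup : u * p ^ 4 = dilate (τ * f) * (X ^ 1 * p ^ 3) + dilate (3 * τ * f ^ 2) * (X ^ 2 * p ^ 2)
      + dilate 5 * (v * p ^ 4 - u * (p ^ 3 * (X * dilate f) + 3 * p ^ 2 * (X * dilate f) ^ 2)) := by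
    simp only [map_mul, map_pow, map_ofNat]
    linear_combination p ^ 4 * hu +
      (p ^ 3 * (X * dilate f) + 3 * p ^ 2 * (X * dilate f) ^ 2) * h5'
  generalize v * p ^ 4 - u * (p ^ 3 * (X * dilate f) + 3 * p ^ 2 * (X * dilate f) ^ 2) = y at hup
  have hp : p ^ 24 = dilate (τ ^ 4) * p ^ 4 - dilate (20 * τ ^ 3) * (u * p ^ 4) +
      dilate 25 * (z * p ^ 4) := by
    simp only [map_mul, map_pow, map_ofNat]
    rw [← h5'] at hz
    linear_combination p ^ 4 * hz
  have hr : 4 < 5 := by norm_num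
  have hd : dissect 4 (u * p ^ 4) = τ * f * (5 * f ^ 3) + 3 * τ * f ^ 2 * (-f ^ 2) +
      5 * dissect 4 y := by
    rw [hup, map_add, map_add, dissect_dilate_mul hr, dissect_dilate_mul hr, dissect_dilate_mul hr,
      dissect_X_pow_mul_of_le (by norm_num), dissect_X_pow_mul_of_le (by norm_num), h3, h2]
  refine ⟨-2 * p ^ 24 - 4 * τ ^ 3 * dissect 4 y + dissect 4 (z * p ^ 4), ?_⟩
  conv_lhs => rw [hp]
  rw [map_add, map_sub, dissect_dilate_mul hr, dissect_dilate_mul hr, dissect_dilate_mul hr, h4, hd]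
  have : p ^ 24 = f ^ 4 * τ ^ 4 := by rw [← mul_pow, hτ]; ring
  rw [this]
  ring

/-- The linear term contributes nothing because D_0(u) = 0 exactly: its four terms contribute -5 +
15 - 5 - 5 = 0. -/
theorem dissect_zero_pentagonalSeries_pow_twenty : ∃ w : ℤ⟦X⟧,
    dilate (pentagonalSeries ℤ) ^ 4 * dissect 0 (pentagonalSeries ℤ ^ 20) =
      pentagonalSeries ℤ ^ 24 + 25 * w := by
  obtain ⟨τ, hτ, h5⟩ := exists_quintic_pentagonalSeries
  have h4 := dissect_four_pentagonalSeries_pow_four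
  have h3 := dissect_three_pentagonalSeries_cube
  have h2 := dissect_two_pentagonalSeries_sq
  have h1 := dissect_one_pentagonalSeries
  specialize h5 _ rfl
  generalize pentagonalSeries ℤ = p at *
  set f := dilate p with hf
  generalize hu : p * (X * dilate f) * (p ^ 3 + 3 * p ^ 2 * (X * dilate f) +
    5 * p * (X * dilate f) ^ 2 + 5 * (X * dilate f) ^ 3) = u at h5
  obtain ⟨z, hz⟩ := exists_sub_five_mul_pow_four (dilate τ) u
  have hr : 0 < 5 := by norm_num
  have hd : dissect 0 u = 0 := by
    have : u = dilate f * (X ^ 1 * p ^ 4) + dilate (3 * f ^ 2) * (X ^ 2 * p ^ 3) +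
        dilate (5 * f ^ 3) * (X ^ 3 * p ^ 2) + dilate (5 * f ^ 4) * (X ^ 4 * p) := by
      rw [← hu]
      simp only [map_mul, map_pow, map_ofNat]
      ring
    rw [this, map_add, map_add, map_add, dissect_dilate_mul hr, dissect_dilate_mul hr,
      dissect_dilate_mul hr, dissect_dilate_mul hr,
      dissect_X_pow_mul_of_lt (by norm_num) (by norm_num),
      dissect_X_pow_mul_of_lt (by norm_num) (by norm_num),
      dissect_X_pow_mul_of_lt (by norm_num) (by norm_num),
      dissect_X_pow_mul_of_lt (by norm_num) (by norm_num), h1, h2, h3, h4]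
    ring
  have hp : p ^ 20 = dilate (τ ^ 4) - dilate (20 * τ ^ 3) * u + dilate 25 * z := by
    simp only [map_mul, map_pow, map_ofNat]
    rw [← h5] at hz
    linear_combination hz
  refine ⟨f ^ 4 * dissect 0 z, ?_⟩
  rw [hp, map_add, map_sub, dissect_dilate_mul hr, dissect_dilate_mul hr, dissect_zero_dilate, hd]
  have : p ^ 24 = f ^ 4 * τ ^ 4 := by rw [← mul_pow, hτ]; ring
  rw [this]
  ring

/-- Modulo 5, D_1(uE) is τf, so D_1(E^21) ≡ (-1 - 20)τ⁴f modulo 25. -/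
theorem dissect_one_pentagonalSeries_pow_twentyOne : ∃ w : ℤ⟦X⟧,
    dilate (pentagonalSeries ℤ) ^ 3 * dissect 1 (pentagonalSeries ℤ ^ 21) =
      4 * pentagonalSeries ℤ ^ 24 + 25 * w := by
  obtain ⟨τ, hτ, h5⟩ := exists_quintic_pentagonalSeries
  have h4 := dissect_four_pentagonalSeries_pow_four
  have h1 := dissect_one_pentagonalSeries
  specialize h5 _ rfl
  generalize pentagonalSeries ℤ = p at *
  set f := dilate p with hf
  set v := (X * dilate f) ^ 3 * p ^ 2 + (X * dilate f) ^ 4 * p with hv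
  obtain ⟨u, hu⟩ : ∃ u, u = X * dilate f * (p ^ 4 + 3 * p ^ 3 * (X * dilate f)) + 5 * v := ⟨_, rfl⟩
  have h5' : p ^ 5 = dilate τ - 5 * u := by rw [h5, hu, hv]; ring
  obtain ⟨z, hz⟩ := exists_sub_five_mul_pow_four (dilate τ) u
  have hup : u * p = X ^ 1 * dilate (τ * f) + dilate (3 * f ^ 2) * (X ^ 2 * p ^ 4)
      + dilate 5 * (v * p - u * (X * dilate f)) := by
    simp only [map_mul, map_pow, map_ofNat]
    linear_combination p * hu + (X * dilate f) * h5'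
  generalize v * p - u * (X * dilate f) = y at hup
  have hp : p ^ 21 = dilate (τ ^ 4) * p - dilate (20 * τ ^ 3) * (u * p) + dilate 25 * (z * p) := by
    simp only [map_mul, map_pow, map_ofNat]
    rw [← h5'] at hz
    linear_combination p * hz
  have hr : 1 < 5 := by norm_num
  have hd : dissect 1 (u * p) = τ * f + 3 * f ^ 2 * (X * (-5 * f ^ 4)) + 5 * dissect 1 y := by
    rw [hup, map_add, map_add, dissect_dilate_mul hr, dissect_dilate_mul hr,
      dissect_X_pow_mul_dilate hr hr, if_pos rfl,
      dissect_X_pow_mul_of_lt (by norm_num) (by norm_num), h4]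
  refine ⟨-p ^ 24 + 12 * τ ^ 3 * X * f ^ 9 - 4 * f ^ 3 * τ ^ 3 * dissect 1 y +
    f ^ 3 * dissect 1 (z * p), ?_⟩
  conv_lhs => rw [hp]
  rw [map_add, map_sub, dissect_dilate_mul hr, dissect_dilate_mul hr, dissect_dilate_mul hr, h1, hd]
  have : p ^ 24 = f ^ 4 * τ ^ 4 := by rw [← mul_pow, hτ]; ring
  rw [this]
  ring

/-- In (τ(q^5) - 5u)^21 the linear term dies since D_0(u) = 0. In the quadratic one 5250 = 42 · 5³,
and D_0(u²) is divisible by 5, its main terms adding to 5 - 6 - 9 = -10. -/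
theorem dissect_zero_pentagonalSeries_pow_oneHundredFive : ∃ w : ℤ⟦X⟧,
    dilate (pentagonalSeries ℤ) ^ 21 * dissect 0 (pentagonalSeries ℤ ^ 105) =
      pentagonalSeries ℤ ^ 126 + 625 * w := by
  obtain ⟨τ, hτ, h5⟩ := exists_quintic_pentagonalSeries
  have h4 := dissect_four_pentagonalSeries_pow_four
  have h3 := dissect_three_pentagonalSeries_cube
  have h2 := dissect_two_pentagonalSeries_sq
  have h1 := dissect_one_pentagonalSeries
  specialize h5 _ rfl
  generalize pentagonalSeries ℤ = p at *
  set f := dilate p with hf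
  set v := (X * dilate f) ^ 3 * p ^ 2 + (X * dilate f) ^ 4 * p with hv
  obtain ⟨u, hu⟩ : ∃ u, u = X * dilate f * (p ^ 4 + 3 * p ^ 3 * (X * dilate f)) + 5 * v := ⟨_, rfl⟩
  have h5' : p ^ 5 = dilate τ - 5 * u := by rw [h5, hu, hv]; ring
  obtain ⟨z, hz⟩ := exists_sub_five_mul_pow_twentyOne (dilate τ) u
  have hr : 0 < 5 := by norm_num
  have hd : dissect 0 u = 0 := by
    have : u = dilate f * (X ^ 1 * p ^ 4) + dilate (3 * f ^ 2) * (X ^ 2 * p ^ 3) +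
        dilate (5 * f ^ 3) * (X ^ 3 * p ^ 2) + dilate (5 * f ^ 4) * (X ^ 4 * p) := by
      rw [hu, hv]
      simp only [map_mul, map_pow, map_ofNat]
      ring
    rw [this, map_add, map_add, map_add, dissect_dilate_mul hr, dissect_dilate_mul hr,
      dissect_dilate_mul hr, dissect_dilate_mul hr,
      dissect_X_pow_mul_of_lt (by norm_num) (by norm_num),
      dissect_X_pow_mul_of_lt (by norm_num) (by norm_num),
      dissect_X_pow_mul_of_lt (by norm_num) (by norm_num),
      dissect_X_pow_mul_of_lt (by norm_num) (by norm_num), h1, h2, h3, h4]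
    ring
  obtain ⟨y, hy⟩ : ∃ y, u ^ 2 = dilate (τ * f ^ 2) * (X ^ 2 * p ^ 3) +
      dilate (6 * τ * f ^ 3) * (X ^ 3 * p ^ 2) + dilate (9 * τ * f ^ 4) * (X ^ 4 * p) +
      dilate 5 * y := by
    refine ⟨2 * (X * dilate f * (p ^ 4 + 3 * p ^ 3 * (X * dilate f))) * v + 5 * v ^ 2 -
      u * (X * dilate f) ^ 2 * (p ^ 3 + 6 * p ^ 2 * (X * dilate f) +
        9 * p * (X * dilate f) ^ 2), ?_⟩
    simp only [map_mul, map_pow, map_ofNat]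
    linear_combination (u + X * dilate f * (p ^ 4 + 3 * p ^ 3 * (X * dilate f)) + 5 * v) * hu +
      (X * dilate f) ^ 2 * (p ^ 3 + 6 * p ^ 2 * (X * dilate f) + 9 * p * (X * dilate f) ^ 2) * h5'
  have hd2 : dissect 0 (u ^ 2) = -10 * τ * X * f ^ 5 + 5 * dissect 0 y := by
    rw [hy, map_add, map_add, map_add, dissect_dilate_mul hr, dissect_dilate_mul hr,
      dissect_dilate_mul hr, dissect_dilate_mul hr,
      dissect_X_pow_mul_of_lt (by norm_num) (by norm_num),
      dissect_X_pow_mul_of_lt (by norm_num) (by norm_num),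
      dissect_X_pow_mul_of_lt (by norm_num) (by norm_num), h1, h2, h3]
    ring
  have hp : p ^ 105 = dilate (τ ^ 21) - dilate (105 * τ ^ 20) * u +
      dilate (5250 * τ ^ 19) * u ^ 2 + dilate 625 * z := by
    simp only [map_mul, map_pow, map_ofNat]
    rw [← h5'] at hz
    linear_combination hz
  refine ⟨f ^ 21 * (-84 * τ ^ 20 * X * f ^ 5 + 42 * τ ^ 19 * dissect 0 y + dissect 0 z), ?_⟩
  rw [hp, map_add, map_add, map_sub, dissect_dilate_mul hr, dissect_dilate_mul hr,
    dissect_dilate_mul hr, dissect_zero_dilate, hd, hd2]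
  have : p ^ 126 = f ^ 21 * τ ^ 21 := by rw [← mul_pow, hτ]; ring
  rw [this]
  ring

end PowerSeries

/-! ### Frobenius congruences and integral exponents -/

namespace PowerSeries

theorem five_dvd_pow_five_sub_dilate (f : ℤ⟦X⟧) : (5 : ℤ⟦X⟧) ∣ f ^ 5 - dilate f := by
  have h : map (Int.castRingHom (ZMod 5)) (f ^ 5 - dilate f) = 0 := by
    have : Fact (Nat.Prime 5) := ⟨by norm_num⟩
    have hF := MvPowerSeries.map_frobenius_expand (R := ZMod 5) (p := 5) (by norm_num)
      (f := map (Int.castRingHom (ZMod 5)) f)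
    rw [ZMod.frobenius_zmod] at hF
    rw [map_sub, map_pow, map_expand, sub_eq_zero, ← hF]
    exact RingHom.congr_fun MvPowerSeries.map_id _
  refine ⟨mk fun n => coeff n (f ^ 5 - dilate f) / 5, ?_⟩
  ext n
  have hn := congrArg (coeff n) h
  rw [coeff_map, map_zero, eq_intCast, ZMod.intCast_zmod_eq_zero_iff_dvd] at hn
  rw [← map_ofNat (C (R := ℤ)), coeff_C_mul, coeff_mk]
  exact (Int.mul_ediv_cancel' hn).symm

theorem five_pow_dvd_pow_sub_dilate_pow (f : ℤ⟦X⟧) (k : ℕ) :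
    (5 : ℤ⟦X⟧) ^ (k + 1) ∣ f ^ 5 ^ (k + 1) - dilate f ^ 5 ^ k := by
  have := dvd_sub_pow_of_dvd_sub (p := 5) (five_dvd_pow_five_sub_dilate f) k
  rwa [← pow_mul, ← pow_succ'] at this

theorem ofNat_eq_zero_of_zmod (m : ℕ) [m.AtLeastTwo] : (OfNat.ofNat m : (ZMod m)⟦X⟧) = 0 := by
  rw [← map_ofNat (C (R := ZMod m)), ← Nat.cast_ofNat (R := ZMod m)]
  exact (congrArg C (ZMod.natCast_self m)).trans (map_zero _)

theorem map_pow_eq_dilate_pow (f : ℤ⟦X⟧) (k m : ℕ) (hm : m = 5 ^ (k + 1)) :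
    map (Int.castRingHom (ZMod m)) f ^ m = dilate (map (Int.castRingHom (ZMod m)) f ^ 5 ^ k) := by
  obtain ⟨g, hg⟩ := five_pow_dvd_pow_sub_dilate_pow f k
  have h := congrArg (map (Int.castRingHom (ZMod m))) hg
  have h0 : (5 : (ZMod m)⟦X⟧) ^ (k + 1) = 0 := by
    have : (5 : (ZMod m)⟦X⟧) ^ (k + 1) = C ((m : ℕ) : ZMod m) := by
      rw [hm]
      push_cast
      rw [map_pow, map_ofNat]
    rw [this, ZMod.natCast_self, map_zero]
  rw [map_sub, map_mul, map_pow, map_pow, map_pow, map_expand, map_ofNat, h0, zero_mul,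
    sub_eq_zero, ← hm] at h
  rw [h, map_pow]

/-- A factor 5 already present makes the congruence f⁵ ≡ f(q^5) modulo 5 sufficient modulo 25. -/
theorem five_mul_pow_eq_five_mul_dilate_pow (f : ℤ⟦X⟧) (w : ℕ) :
    5 * map (Int.castRingHom (ZMod 25)) f ^ (5 * w) =
      5 * dilate (map (Int.castRingHom (ZMod 25)) f ^ w) := by
  obtain ⟨g, hg⟩ := (five_dvd_pow_five_sub_dilate f).trans
    (sub_dvd_pow_sub_pow (f ^ 5) (dilate f) w)
  have h := congrArg (fun x => map (Int.castRingHom (ZMod 25)) (5 * x)) hg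
  simp only [map_sub, map_mul, map_pow, map_expand, map_ofNat] at h
  rw [map_pow, pow_mul]
  linear_combination h + map (Int.castRingHom (ZMod 25)) g * ofNat_eq_zero_of_zmod 25

theorem dvd_coeff_of_coeff_map_eq_zero {m : ℕ} {f : ℤ⟦X⟧} {n : ℕ}
    (h : coeff n (map (Int.castRingHom (ZMod m)) f) = 0) : (m : ℤ) ∣ coeff n f := by
  rwa [coeff_map, eq_intCast, ZMod.intCast_zmod_eq_zero_iff_dvd] at h

/-- D_4(E^(4 + 25w)) ≡ -5 E(q^5)^(4 + w) modulo 25 is a series in q^5. -/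
theorem coeff_pentagonalSeries_pow_dvd_of_four (w n : ℕ) {r : ℕ} (hr : r < 5) (hr0 : r ≠ 0) :
    (25 : ℤ) ∣ coeff (5 * (5 * n + r) + 4) (pentagonalSeries ℤ ^ (4 + 25 * w)) := by
  refine dvd_coeff_of_coeff_map_eq_zero (m := 25) ?_
  have h4 := congrArg (map (Int.castRingHom (ZMod 25))) dissect_four_pentagonalSeries_pow_four
  have h25 := map_pow_eq_dilate_pow (pentagonalSeries ℤ) 1 25 (by norm_num)
  have h5 := five_mul_pow_eq_five_mul_dilate_pow (pentagonalSeries ℤ) (4 + w)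
  have h5' := five_mul_pow_eq_five_mul_dilate_pow (pentagonalSeries ℤ) w
  simp only [map_mul, map_neg, map_pow, map_dissect, map_ofNat, map_expand] at h4
  rw [map_pow]
  generalize map (Int.castRingHom (ZMod 25)) (pentagonalSeries ℤ) = p at *
  rw [← coeff_dissect, ← coeff_dissect, pow_add, pow_mul, h25, ← map_pow, mul_comm,
    dissect_dilate_mul (by norm_num), h4]
  have : (p ^ 5 ^ 1) ^ w * (-5 * dilate p ^ 4) = dilate (-5 * p ^ (4 + w)) := by
    simp only [map_mul, map_neg, map_ofNat, map_pow, pow_add, ← pow_mul, pow_one] at h5' ⊢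
    linear_combination -dilate p ^ 4 * h5'
  rw [this, dissect_dilate hr hr0, map_zero]

theorem dissect_map_pentagonalSeries_eq_zero {R : Type*} [CommRing R] (φ : ℤ →+* R) {r : ℕ}
    (hr : r = 3 ∨ r = 4) : dissect r (map φ (pentagonalSeries ℤ)) = 0 := by
  rw [← map_dissect, dissect_pentagonalSeries_eq_zero hr, map_zero]

theorem isUnit_map_pentagonalSeries {R : Type*} [CommRing R] (φ : ℤ →+* R) :
    IsUnit (map φ (pentagonalSeries ℤ)) := by
  rw [map_pentagonalSeries]
  exact isUnit_of_constantCoeff_eq_one (constantCoeff_pentagonalSeries R)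

/-- D_4 D_1 of the power is 20 E(q^5)^(4 + w) E modulo 25, and E has no exponents 3 or 4 modulo 5.
-/
theorem coeff_pentagonalSeries_pow_dvd_of_twentyOne (w n : ℕ) {r : ℕ} (hr : r = 3 ∨ r = 4) :
    (25 : ℤ) ∣ coeff (5 * (5 * (5 * n + r) + 4) + 1) (pentagonalSeries ℤ ^ (21 + 125 * w)) := by
  refine dvd_coeff_of_coeff_map_eq_zero (m := 25) ?_
  obtain ⟨y, hy⟩ := dissect_one_pentagonalSeries_pow_twentyOne
  obtain ⟨z, hz⟩ := dissect_four_pentagonalSeries_pow_twentyFour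
  have h21 := congrArg (map (Int.castRingHom (ZMod 25))) hy
  have h24 := congrArg (map (Int.castRingHom (ZMod 25))) hz
  have h25 := map_pow_eq_dilate_pow (pentagonalSeries ℤ) 1 25 (by norm_num)
  have h5 := five_mul_pow_eq_five_mul_dilate_pow (pentagonalSeries ℤ) (4 + w)
  have hsec := dissect_map_pentagonalSeries_eq_zero (Int.castRingHom (ZMod 25)) hr
  have hu := isUnit_map_pentagonalSeries (Int.castRingHom (ZMod 25))
  simp only [map_add, map_mul, map_pow, map_dissect, map_ofNat, map_expand,
    ofNat_eq_zero_of_zmod 25, zero_mul, add_zero] at h21 h24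
  rw [map_pow]
  generalize map (Int.castRingHom (ZMod 25)) (pentagonalSeries ℤ) = p at *
  rw [← coeff_dissect, ← coeff_dissect, ← coeff_dissect]
  have e1 : p ^ (21 + 125 * w) = dilate (p ^ (25 * w)) * p ^ 21 := by
    rw [pow_add, show 125 * w = 25 * (5 * w) by ring, pow_mul, h25, ← map_pow, ← pow_mul]
    ring_nf
  have e2 : dilate (p ^ 3) * dissect 1 (p ^ (21 + 125 * w)) = dilate (4 * p ^ (5 * w)) * p ^ 24 := by
    rw [e1, dissect_dilate_mul (by norm_num), pow_mul, h25, ← map_pow]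
    simp only [map_mul, map_pow, map_ofNat, pow_mul, pow_one] at h21 ⊢
    linear_combination (dilate p ^ 5) ^ w * h21
  have e3 := congrArg (dissect 4) e2
  rw [dissect_dilate_mul (by norm_num), dissect_dilate_mul (by norm_num), h24] at e3
  have e4 : dissect 4 (dissect 1 (p ^ (21 + 125 * w))) = dilate (20 * p ^ (4 + w)) * p := by
    apply (hu.pow 3).mul_left_cancel
    rw [e3]
    have : p ^ (5 * (4 + w)) * p ^ 4 = p ^ (5 * w) * p ^ 24 := by ring
    simp only [map_mul, map_ofNat] at h5 ⊢
    linear_combination 4 * p ^ 4 * h5 - 20 * this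
  rw [e4, dissect_dilate_mul (by omega), hsec, mul_zero, map_zero]

/-- D_4 D_0 of the power is 5 E(q^5)^(4 + w) modulo 25, a series in q^5. -/
theorem coeff_pentagonalSeries_pow_dvd_of_twenty (w n : ℕ) {r : ℕ} (hr : r = 3 ∨ r = 4) :
    (25 : ℤ) ∣ coeff (5 * (5 * (5 * n + r) + 4) + 0) (pentagonalSeries ℤ ^ (20 + 125 * w)) := by
  refine dvd_coeff_of_coeff_map_eq_zero (m := 25) ?_
  obtain ⟨y, hy⟩ := dissect_zero_pentagonalSeries_pow_twenty
  obtain ⟨z, hz⟩ := dissect_four_pentagonalSeries_pow_twentyFour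
  have h20 := congrArg (map (Int.castRingHom (ZMod 25))) hy
  have h24 := congrArg (map (Int.castRingHom (ZMod 25))) hz
  have h25 := map_pow_eq_dilate_pow (pentagonalSeries ℤ) 1 25 (by norm_num)
  have h5 := five_mul_pow_eq_five_mul_dilate_pow (pentagonalSeries ℤ) (4 + w)
  have hu := isUnit_map_pentagonalSeries (Int.castRingHom (ZMod 25))
  simp only [map_add, map_mul, map_pow, map_dissect, map_ofNat, map_expand,
    ofNat_eq_zero_of_zmod 25, zero_mul, add_zero] at h20 h24
  rw [map_pow]
  generalize map (Int.castRingHom (ZMod 25)) (pentagonalSeries ℤ) = p at *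
  rw [← coeff_dissect, ← coeff_dissect, ← coeff_dissect]
  have e1 : p ^ (20 + 125 * w) = dilate (p ^ (25 * w)) * p ^ 20 := by
    rw [pow_add, show 125 * w = 25 * (5 * w) by ring, pow_mul, h25, ← map_pow, ← pow_mul]
    ring_nf
  have e2 : dilate (p ^ 4) * dissect 0 (p ^ (20 + 125 * w)) = dilate (p ^ (5 * w)) * p ^ 24 := by
    rw [e1, dissect_dilate_mul (by norm_num), pow_mul, h25, ← map_pow]
    simp only [map_pow, pow_mul, pow_one] at h20 ⊢
    linear_combination (dilate p ^ 5) ^ w * h20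
  have e3 := congrArg (dissect 4) e2
  rw [dissect_dilate_mul (by norm_num), dissect_dilate_mul (by norm_num), h24] at e3
  have e4 : dissect 4 (dissect 0 (p ^ (20 + 125 * w))) = dilate (5 * p ^ (4 + w)) := by
    apply (hu.pow 4).mul_left_cancel
    rw [e3]
    have : p ^ (5 * (4 + w)) * p ^ 4 = p ^ (5 * w) * p ^ 24 := by ring
    simp only [map_mul, map_ofNat] at h5 ⊢
    linear_combination p ^ 4 * h5 - 5 * this
  rw [e4, dissect_dilate (by omega) (by omega), map_zero]

/-- The 4 in the exponent is chosen so that 125 · 4 + 126 = 625 + 1: up to a unit in q^5, D_0 of the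
power is then a series in q^5 times E. -/
theorem coeff_pentagonalSeries_pow_dvd_of_oneHundredFive (w n : ℕ) {r : ℕ} (hr : r = 3 ∨ r = 4) :
    (625 : ℤ) ∣ coeff (5 * (5 * n + r) + 0)
      (pentagonalSeries ℤ ^ (105 + 625 * (4 + 5 * w))) := by
  refine dvd_coeff_of_coeff_map_eq_zero (m := 625) ?_
  obtain ⟨y, hy⟩ := dissect_zero_pentagonalSeries_pow_oneHundredFive
  have h105 := congrArg (map (Int.castRingHom (ZMod 625))) hy
  have h625 := map_pow_eq_dilate_pow (pentagonalSeries ℤ) 3 625 (by norm_num)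
  have hsec := dissect_map_pentagonalSeries_eq_zero (Int.castRingHom (ZMod 625)) hr
  have hu := isUnit_map_pentagonalSeries (Int.castRingHom (ZMod 625))
  simp only [map_add, map_mul, map_pow, map_dissect, map_ofNat, map_expand,
    ofNat_eq_zero_of_zmod 625, zero_mul, add_zero] at h105
  rw [map_pow]
  generalize map (Int.castRingHom (ZMod 625)) (pentagonalSeries ℤ) = p at *
  rw [← coeff_dissect, ← coeff_dissect]
  have e1 : p ^ (105 + 625 * (4 + 5 * w)) = dilate (p ^ (125 * (4 + 5 * w))) * p ^ 105 := by
    rw [pow_add, pow_mul p 625, h625, ← map_pow, ← pow_mul]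
    ring_nf
  have e2 : dilate (p ^ 21) * dissect 0 (p ^ (105 + 625 * (4 + 5 * w))) =
      dilate (p ^ (125 * (1 + w))) * p := by
    have h1 : p ^ (125 * (4 + 5 * w)) * p ^ 126 = p ^ (625 * (1 + w)) * p := by ring
    have h2 : p ^ (625 * (1 + w)) = dilate (p ^ (125 * (1 + w))) := by
      rw [pow_mul p 625, h625, ← map_pow, ← pow_mul]
      ring_nf
    rw [e1, dissect_dilate_mul (by norm_num), ← h2, ← h1, map_pow]
    linear_combination p ^ (125 * (4 + 5 * w)) * h105
  have e3 := congrArg (dissect r) e2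
  rw [dissect_dilate_mul (by omega), dissect_dilate_mul (by omega), hsec, mul_zero] at e3
  rw [(hu.pow 21).mul_right_eq_zero.1 e3, map_zero]

end PowerSeries

/-! ### Passage to the rational exponents -/

/-- These w tend 5-adically to -1/6; affine functions of w approximate all four exponents. -/
theorem exists_six_mul_add_one_eq (j : ℕ) : ∃ w : ℕ, (6 : ℤ) * w + 1 = 5 ^ j * 5 ^ j := by
  induction j with
  | zero => exact ⟨0, by norm_num⟩
  | succ j ih =>
    obtain ⟨w, hw⟩ := ih
    exact ⟨25 * w + 4, by push_cast; linear_combination 25 * hw⟩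

theorem RatCongZero.of_dvd {x : ℚ} {m n : ℕ} (h : RatCongZero x n) (hmn : m ∣ n) :
    RatCongZero x m :=
  (Int.natCast_dvd_natCast.2 hmn).trans h

theorem isCoprime_six_five : IsCoprime (6 : ℤ) ((5 : ℕ) : ℤ) :=
  ⟨1, -1, by norm_num⟩

theorem fracPartition_neg_one_sixth (n : ℕ) {r : ℕ} (hr : r < 5) (hr0 : r ≠ 0) :
    RatCongZero (fracPartition (-1 / 6) (5 * (5 * n + r) + 4)) 25 := by
  have := ratCongZero_fracPartition (by norm_num) isCoprime_six_five 2 (5 * (5 * n + r) + 4) (-1)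
    fun j => ?_
  · simpa using this
  · obtain ⟨w, hw⟩ := exists_six_mul_add_one_eq j
    refine ⟨4 + 25 * w, ⟨25 * 5 ^ j, ?_⟩, ?_⟩
    · push_cast
      linear_combination 25 * hw
    · simpa using PowerSeries.coeff_pentagonalSeries_pow_dvd_of_four w n hr hr0

theorem fracPartition_one_sixth (n : ℕ) {r : ℕ} (hr : r = 3 ∨ r = 4) :
    RatCongZero (fracPartition (1 / 6) (5 * (5 * (5 * n + r) + 4) + 1)) 25 := by
  have := ratCongZero_fracPartition (by norm_num) isCoprime_six_five 2
    (5 * (5 * (5 * n + r) + 4) + 1) 1 fun j => ?_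
  · simpa using this
  · obtain ⟨w, hw⟩ := exists_six_mul_add_one_eq j
    refine ⟨21 + 125 * w, ⟨125 * 5 ^ j, ?_⟩, ?_⟩
    · push_cast
      linear_combination 125 * hw
    · simpa using PowerSeries.coeff_pentagonalSeries_pow_dvd_of_twentyOne w n hr

theorem fracPartition_neg_five_sixths (n : ℕ) {r : ℕ} (hr : r = 3 ∨ r = 4) :
    RatCongZero (fracPartition (-5 / 6) (5 * (5 * (5 * n + r) + 4))) 25 := by
  have := ratCongZero_fracPartition (by norm_num) isCoprime_six_five 2
    (5 * (5 * (5 * n + r) + 4)) (-5) fun j => ?_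
  · simpa using this
  · obtain ⟨w, hw⟩ := exists_six_mul_add_one_eq j
    refine ⟨20 + 125 * w, ⟨125 * 5 ^ j, ?_⟩, ?_⟩
    · push_cast
      linear_combination 125 * hw
    · simpa using PowerSeries.coeff_pentagonalSeries_pow_dvd_of_twenty w n hr

theorem fracPartition_five_sixths (n : ℕ) {r : ℕ} (hr : r = 3 ∨ r = 4) :
    RatCongZero (fracPartition (5 / 6) (5 * (5 * n + r))) 625 := by
  have := ratCongZero_fracPartition (by norm_num) isCoprime_six_five 4
    (5 * (5 * n + r)) 5 fun j => ?_
  · simpa using this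
  · obtain ⟨w, hw⟩ := exists_six_mul_add_one_eq j
    -- 6N - 5 = 15625(6w + 1).
    refine ⟨105 + 625 * (4 + 5 * (5 * w)), ⟨15625 * 5 ^ j, ?_⟩, ?_⟩
    · push_cast
      linear_combination 15625 * hw
    · simpa using PowerSeries.coeff_pentagonalSeries_pow_dvd_of_oneHundredFive (5 * w) n hr

theorem mainTheorem2 :
    (∀ n : ℕ, ∀ r ∈ ({9, 14, 19, 24} : Set ℕ),
      RatCongZero (fracPartition (-1 / 6) (25 * n + r)) 25) ∧
    (∀ n : ℕ, ∀ r ∈ ({96, 121} : Set ℕ),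
      RatCongZero (fracPartition (1 / 6) (125 * n + r)) 25) ∧
    (∀ n : ℕ, ∀ r ∈ ({95, 120} : Set ℕ),
      RatCongZero (fracPartition (-5 / 6) (125 * n + r)) 25) ∧
    (∀ n : ℕ, ∀ r ∈ ({15, 20} : Set ℕ),
      RatCongZero (fracPartition (5 / 6) (25 * n + r)) 125) ∧
    (∀ n : ℕ, ∀ r ∈ ({65, 70} : Set ℕ),
      RatCongZero (fracPartition (5 / 6) (125 * n + r)) 625) := by
  simp only [Set.mem_insert_iff, Set.mem_singleton_iff]
  refine ⟨fun n r hr => ?_, fun n r hr => ?_, fun n r hr => ?_, fun n r hr => ?_, fun n r hr => ?_⟩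
  · obtain ⟨s, hs, hs0, rfl⟩ : ∃ s, s < 5 ∧ s ≠ 0 ∧ r = 5 * s + 4 :=
      ⟨r / 5, by omega, by omega, by omega⟩
    convert fracPartition_neg_one_sixth n hs hs0 using 2
    ring
  · obtain ⟨s, hs, rfl⟩ : ∃ s, (s = 3 ∨ s = 4) ∧ r = 25 * s + 21 := ⟨r / 25, by omega, by omega⟩
    convert fracPartition_one_sixth n hs using 2
    ring
  · obtain ⟨s, hs, rfl⟩ : ∃ s, (s = 3 ∨ s = 4) ∧ r = 25 * s + 20 := ⟨r / 25, by omega, by omega⟩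
    convert fracPartition_neg_five_sixths n hs using 2
    ring
  · obtain ⟨s, hs, rfl⟩ : ∃ s, (s = 3 ∨ s = 4) ∧ r = 5 * s := ⟨r / 5, by omega, by omega⟩
    -- The congruence holds even modulo 625, so the last family is the subprogression n ↦ 5n + 2 of
    -- this one.
    refine RatCongZero.of_dvd (n := 625) ?_ (by norm_num)
    convert fracPartition_five_sixths n hs using 2
    ring
  · obtain ⟨s, hs, rfl⟩ : ∃ s, (s = 3 ∨ s = 4) ∧ r = 5 * (10 + s) :=
      ⟨r / 5 - 10, by omega, by omega⟩
    convert fracPartition_five_sixths (5 * n + 2) hs using 2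
    ring
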